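/- Let $U=\{(\alpha,\beta)\in\mathbb R^2: 0<\beta\le\alpha\le 1\}$ and, for $(\alpha,\beta)\in U$, let $T_{\alpha,\beta}:[0,1]\to[0,1]$ be the interval translation map $$T_{\alpha,\beta}(x)=\begin{cases}x+\alpha,& x\in[0,1-\alpha),\\ x+\beta,& x\in[1-\alpha,1-\beta),\\ x-1+\beta,& x\in[1-\beta,1].\end{cases}$$ Let $G(\alpha,\beta)=\left(\frac{\beta}{\alpha},\ \frac{\beta-1}{\alpha}+\left\lfloor\frac1\alpha\right\rfloor\right)$ and let $\Omega_\infty=\{(\alpha,\beta): G^n(\alpha,\beta)\in U^\circ\text{ for all }n\ge 0\}$ be the set of parameters of infinite type, with the topology induced from $\mathbb R^2$. Let $X_{\alpha,\beta}\subset\{1,2,3\}^{\mathbb N}$ be the closure of the orbit, under the left shift $\sigma$, of the itinerary of the point $1$ under $T_{\alpha,\beta}$ with respect to the partition $[0,1-\alpha),[1-\alpha,1-\beta),[1-\beta,1]$ with symbols $1,2,3$. Call $c\in\mathbb C$ an eigenvalue of $T_{\alpha,\beta}$ if it is a continuous eigenvalue, that is, there is a continuous $f:X_{\alpha,\beta}\to\mathbb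 C$, $f\not\equiv 0$, with $f\circ\sigma=cf$, or a measurable eigenvalue, that is, there are a $T_{\alpha,\beta}$-invariant Borel probability measure $\mu$ on $[0,1]$ and a nonzero $f\in L^2(\mu)$ with $f\circ T_{\alpha,\beta}=cf$ $\mu$-almost everywhere. Then the set of parameters $(\alpha,\beta)\in\Omega_\infty$ for which $T_{\alpha,\beta}$ has no eigenvalue $e^{2\pi i\xi}$ with $\xi\in(0,1)$ contains a dense $G_\delta$ subset of $\Omega_\infty$. -/

import Mathlib

open MeasureTheory

noncomputable section

namespace ITM

/-- The parameter space `U = {(α, β) : 0 < β ≤ α ≤ 1}`. -/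
def U : Set (ℝ × ℝ) := {p | 0 < p.2 ∧ p.2 ≤ p.1 ∧ p.1 ≤ 1}

/-- The renormalization map `G(α, β) = (β/α, (β - 1)/α + ⌊1/α⌋)`. -/
def G (p : ℝ × ℝ) : ℝ × ℝ :=
  (p.2 / p.1, (p.2 - 1) / p.1 + (⌊1 / p.1⌋ : ℝ))

/-- The parameters of infinite type: all iterates of `G` stay in the interior of `U`. -/
def OmegaInfty : Set (ℝ × ℝ) := {p | ∀ n : ℕ, G^[n] p ∈ interior U}

/-- The interval translation map `T_{α,β}`. Only its values on `[0, 1]` matter. -/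
def T (p : ℝ × ℝ) (x : ℝ) : ℝ :=
  if x < 1 - p.1 then x + p.1
  else if x < 1 - p.2 then x + p.2
  else x - 1 + p.2

/-- The symbol of the partition element `[0, 1 - α)`, `[1 - α, 1 - β)`, `[1 - β, 1]`
that contains the point; the symbols `0, 1, 2` stand for `1, 2, 3`. -/
def symbol (p : ℝ × ℝ) (x : ℝ) : Fin 3 :=
  if x < 1 - p.1 then 0 else if x < 1 - p.2 then 1 else 2

/-- The itinerary of `x` under `T_{α,β}`. -/
def itinerary (p : ℝ × ℝ) (x : ℝ) : ℕ → Fin 3 := fun n => symbol p ((T p)^[n] x)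

/-- The left shift on one-sided sequences. -/
def shift (x : ℕ → Fin 3) : ℕ → Fin 3 := fun n => x (n + 1)

/-- The subshift of `T_{α,β}`: the shift-orbit closure, in the product topology, of the
itinerary of the point `1`. -/
def subshift (p : ℝ × ℝ) : Set (ℕ → Fin 3) :=
  closure (Set.range fun n : ℕ => shift^[n] (itinerary p 1))

/-- `c` is a continuous eigenvalue: the Koopman operator of the subshift has a nonzero continuous
eigenfunction with eigenvalue `c`. -/
def IsContinuousEigenvalue (p : ℝ × ℝ) (c : ℂ) : Prop :=
  ∃ f : (ℕ → Fin 3) → ℂ, ContinuousOn f (subshift p) ∧ (∃ x ∈ subshift p, f x ≠ 0) ∧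
    ∀ x ∈ subshift p, f (shift x) = c * f x

/-- `c` is a measurable eigenvalue: for some `T_{α,β}`-invariant Borel probability measure `μ` on
`[0, 1]`, the Koopman operator on `L²(μ)` has a nonzero eigenfunction with eigenvalue `c`. -/
def IsMeasurableEigenvalue (p : ℝ × ℝ) (c : ℂ) : Prop :=
  ∃ μ : Measure ℝ, IsProbabilityMeasure μ ∧ μ (Set.Icc 0 1)ᶜ = 0 ∧ MeasurePreserving (T p) μ μ ∧
    ∃ f : ℝ → ℂ, MemLp f 2 μ ∧ ¬ (f =ᵐ[μ] 0) ∧ ∀ᵐ x ∂μ, f (T p x) = c * f x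

/-- `c` is an eigenvalue of `T_{α,β}`, continuous or measurable. -/
def IsEigenvalue (p : ℝ × ℝ) (c : ℂ) : Prop :=
  IsContinuousEigenvalue p c ∨ IsMeasurableEigenvalue p c

end ITM

end

namespace ITM

open Filter Topology

theorem interior_U : interior U = {p : ℝ × ℝ | 0 < p.2 ∧ p.2 < p.1 ∧ p.1 < 1} := by
  apply Set.Subset.antisymm
  · intro p hp
    have hU : p ∈ U := interior_subset hp
    have hc : Tendsto (fun t : ℝ => (p.1 + t, p.2)) (𝓝 0) (𝓝 p) := by
      have : Continuous fun t : ℝ => (p.1 + t, p.2) := by fun_prop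
      simpa using this.tendsto 0
    have hev := hc.eventually (mem_interior_iff_mem_nhds.1 hp)
    obtain ⟨ε, hε, h⟩ := Metric.eventually_nhds_iff.1 hev
    have h1 := h (y := ε / 2) (by rw [Real.dist_eq, sub_zero, abs_of_pos] <;> linarith)
    have h2 := h (y := -(ε / 2)) (by rw [Real.dist_eq, sub_zero, abs_neg, abs_of_pos] <;> linarith)
    simp only [U, Set.mem_ofPred_eq] at h1 h2 hU ⊢
    exact ⟨hU.1, by linarith, by linarith⟩
  · refine interior_maximal (fun p hp => ⟨hp.1, hp.2.1.le, hp.2.2.le⟩) ?_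
    exact (isOpen_lt continuous_const continuous_snd).inter
      ((isOpen_lt continuous_snd continuous_fst).inter (isOpen_lt continuous_fst continuous_const))

theorem mem_interior_U {p : ℝ × ℝ} : p ∈ interior U ↔ 0 < p.2 ∧ p.2 < p.1 ∧ p.1 < 1 := by
  rw [interior_U]; rfl

/-- The integer `⌊1/α⌋` used by the renormalization map. -/
noncomputable def digit (p : ℝ × ℝ) : ℕ := ⌊1 / p.1⌋₊

/-- The inverse branch of `G` on the parameters with digit `k`. -/
noncomputable def branch (k : ℕ) (p : ℝ × ℝ) : ℝ × ℝ :=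
  (1 / (k + p.1 - p.2), p.1 / (k + p.1 - p.2))

theorem G_eq {p : ℝ × ℝ} (hp : 0 < p.1) :
    G p = (p.2 / p.1, (p.2 - 1) / p.1 + (digit p : ℝ)) := by
  rw [G, digit, natCast_floor_eq_intCast_floor (by positivity)]

theorem one_le_digit {p : ℝ × ℝ} (hp : p ∈ interior U) : 1 ≤ digit p := by
  obtain ⟨h0, h1, h2⟩ := mem_interior_U.1 hp
  have : 0 < p.1 := h0.trans h1
  rw [digit, Nat.one_le_floor_iff, le_div_iff₀ this]
  linarith

theorem digit_lt {p : ℝ × ℝ} (hp : p ∈ interior U) (hG : G p ∈ interior U) :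
    (digit p : ℝ) < 1 / p.1 := by
  obtain ⟨h0, h1, h2⟩ := mem_interior_U.1 hp
  have hpos : 0 < p.1 := h0.trans h1
  rw [G_eq hpos] at hG
  have := (mem_interior_U.1 hG).2.1
  simp only [sub_div] at this
  linarith

theorem lt_digit_add_one (p : ℝ × ℝ) : 1 / p.1 < digit p + 1 := Nat.lt_floor_add_one _

theorem digit_mul_lt {p : ℝ × ℝ} (hp : p ∈ interior U) (hG : G p ∈ interior U) :
    (digit p : ℝ) * p.1 < 1 := by
  obtain ⟨h0, h1, h2⟩ := mem_interior_U.1 hp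
  exact (lt_div_iff₀ (h0.trans h1)).1 (digit_lt hp hG)

theorem branch_spec {k : ℕ} (hk : 1 ≤ k) {p : ℝ × ℝ} (hp : p ∈ interior U) :
    branch k p ∈ interior U ∧ digit (branch k p) = k ∧ G (branch k p) = p := by
  obtain ⟨h0, h1, h2⟩ := mem_interior_U.1 hp
  have hk' : (1 : ℝ) ≤ k := by exact_mod_cast hk
  have hD : 1 < k + p.1 - p.2 := by linarith
  have hD0 : 0 < k + p.1 - p.2 := by linarith
  have hdig : digit (branch k p) = k := by
    rw [digit, branch, one_div_one_div, Nat.floor_eq_iff hD0.le]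
    constructor <;> linarith
  refine ⟨mem_interior_U.2 ⟨?_, ?_, ?_⟩, hdig, ?_⟩
  · exact div_pos (h0.trans h1) hD0
  · exact div_lt_div_of_pos_right h2 hD0
  · exact (div_lt_one hD0).2 hD
  · rw [G_eq (by exact div_pos one_pos hD0), hdig]
    simp only [branch]
    ext
    · field_simp
    · simp only; field_simp; ring

theorem mem_interior_of_mem {p : ℝ × ℝ} (hp : p ∈ OmegaInfty) : p ∈ interior U := hp 0

theorem iterate_mem {p : ℝ × ℝ} (hp : p ∈ OmegaInfty) (n : ℕ) : G^[n] p ∈ OmegaInfty := by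
  intro m
  rw [← Function.iterate_add_apply]
  exact hp _

theorem G_mem {p : ℝ × ℝ} (hp : p ∈ OmegaInfty) : G p ∈ OmegaInfty := iterate_mem hp 1

theorem branch_mem {k : ℕ} (hk : 1 ≤ k) {p : ℝ × ℝ} (hp : p ∈ OmegaInfty) :
    branch k p ∈ OmegaInfty := by
  have h := branch_spec hk (mem_interior_of_mem hp)
  intro n
  cases n with
  | zero => exact h.1
  | succ n => rw [Function.iterate_succ_apply, h.2.2]; exact hp n

theorem exists_digit_eq_and_iterate_eq {r : ℝ × ℝ} (hr : r ∈ OmegaInfty) (n : ℕ) :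
    ∀ {p : ℝ × ℝ}, p ∈ OmegaInfty →
      ∃ q ∈ OmegaInfty, (∀ i < n, digit (G^[i] q) = digit (G^[i] p)) ∧ G^[n] q = r := by
  induction n with
  | zero => exact fun _ => ⟨r, hr, by simp, rfl⟩
  | succ n ih =>
    intro p hp
    obtain ⟨q, hq, hd, hn⟩ := ih (G_mem hp)
    have hk := one_le_digit (mem_interior_of_mem hp)
    have h := branch_spec hk (mem_interior_of_mem hq)
    refine ⟨branch (digit p) q, branch_mem hk hq, ?_, ?_⟩
    · rintro (_ | i) hi
      · exact h.2.1
      · rw [Function.iterate_succ_apply, h.2.2, Function.iterate_succ_apply]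
        exact hd i (by omega)
    · rw [Function.iterate_succ_apply, h.2.2, hn]

theorem eventually_digit_eq {p : ℝ × ℝ} (hp : p ∈ interior U) (hG : G p ∈ interior U) :
    ∀ᶠ q in 𝓝 p, digit q = digit p := by
  obtain ⟨h0, h1, h2⟩ := mem_interior_U.1 hp
  have hc : ContinuousAt (fun q : ℝ × ℝ => 1 / q.1) p :=
    continuousAt_const.div continuousAt_fst (h0.trans h1).ne'
  filter_upwards [hc.eventually (lt_mem_nhds (digit_lt hp hG)),
    hc.eventually (gt_mem_nhds (lt_digit_add_one p))] with q hq1 hq2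
  exact (Nat.floor_eq_iff (le_trans (Nat.cast_nonneg _) hq1.le)).2 ⟨hq1.le, hq2⟩

theorem continuousAt_G {p : ℝ × ℝ} (hp : p ∈ interior U) (hG : G p ∈ interior U) :
    ContinuousAt G p := by
  obtain ⟨h0, h1, h2⟩ := mem_interior_U.1 hp
  have hne : p.1 ≠ 0 := (h0.trans h1).ne'
  have hc : ContinuousAt (fun q : ℝ × ℝ => (q.2 / q.1, (q.2 - 1) / q.1 + (digit p : ℝ))) p := by
    fun_prop (disch := exact hne)
  refine hc.congr ?_
  filter_upwards [eventually_digit_eq hp hG,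
    continuousAt_fst.eventually (lt_mem_nhds (h0.trans h1))] with q hq hq0
  rw [G_eq hq0, hq]

theorem continuousAt_iterate_G {p : ℝ × ℝ} (n : ℕ) (hp : ∀ i ≤ n, G^[i] p ∈ interior U) :
    ContinuousAt (G^[n]) p := by
  induction n with
  | zero => exact continuousAt_id
  | succ n ih =>
    rw [Function.iterate_succ']
    refine ContinuousAt.comp (continuousAt_G (hp n (by omega)) ?_) (ih fun i hi => hp i (by omega))
    rw [← Function.iterate_succ_apply' G]
    exact hp _ le_rfl

theorem isOpen_setOf_iterate_mem (n : ℕ) : IsOpen {p : ℝ × ℝ | ∀ i ≤ n, G^[i] p ∈ interior U} := by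
  refine isOpen_iff_mem_nhds.2 fun p hp => ?_
  have : ∀ i ∈ Set.Iic n, ∀ᶠ q in 𝓝 p, G^[i] q ∈ interior U := fun i hi =>
    (continuousAt_iterate_G i fun j hj => hp j (hj.trans hi)).eventually
      (isOpen_interior.mem_nhds (hp i hi))
  exact (eventually_all_finite (Set.finite_Iic n)).2 this

theorem isGδ_OmegaInfty : IsGδ OmegaInfty := by
  have : OmegaInfty = ⋂ n : ℕ, {p : ℝ × ℝ | ∀ i ≤ n, G^[i] p ∈ interior U} := by
    ext p
    simp only [OmegaInfty, Set.mem_ofPred_eq, Set.mem_iInter]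
    exact ⟨fun h n i _ => h i, fun h n => h n n le_rfl⟩
  rw [this]
  exact IsGδ.iInter_of_isOpen isOpen_setOf_iterate_mem

/-- The sequence of digits of a parameter along its `G`-orbit. -/
noncomputable def digits (p : ℝ × ℝ) (i : ℕ) : ℕ := digit (G^[i] p)

theorem eventually_digits_eq {p : ℝ × ℝ} (hp : p ∈ OmegaInfty) (n : ℕ) :
    ∀ᶠ q in 𝓝 p, ∀ i < n, digits q i = digits p i := by
  refine (eventually_all_finite (Set.finite_Iio n)).2 fun i _ => ?_
  refine (continuousAt_iterate_G i fun j _ => hp j).eventually (eventually_digit_eq (hp i) ?_)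
  rw [← Function.iterate_succ_apply' G]
  exact hp _

/-! ### Parameters sharing many digits are close -/

theorem snd_eq {p : ℝ × ℝ} (hp : p ∈ interior U) : p.2 = p.1 * (G p).1 := by
  obtain ⟨h0, h1, h2⟩ := mem_interior_U.1 hp
  have : p.1 ≠ 0 := (h0.trans h1).ne'
  simp only [G]
  field_simp

theorem fst_mul_eq_one {p : ℝ × ℝ} (hp : p ∈ interior U) (hG : G p ∈ interior U) :
    p.1 * (digit p + (G p).1 * (1 - (G (G p)).1)) = 1 := by
  obtain ⟨h0, h1, h2⟩ := mem_interior_U.1 hp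
  have hpos : 0 < p.1 := h0.trans h1
  have h := snd_eq hG
  have : (G p).1 * (1 - (G (G p)).1) = (G p).1 - (G p).2 := by rw [h]; ring
  rw [this, G_eq hpos]
  simp only
  field_simp
  ring

theorem one_sub_fst_eq {p : ℝ × ℝ} (hp : p ∈ interior U) (hG : G p ∈ interior U)
    (hd : digit p = 1) : 1 - p.1 = p.2 * (1 - (G (G p)).1) := by
  have h := fst_mul_eq_one hp hG
  rw [hd, Nat.cast_one] at h
  rw [snd_eq hp]
  linarith

theorem exists_two_le_digits {p : ℝ × ℝ} (hp : p ∈ OmegaInfty) : ∃ i, 2 ≤ digits p i := by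
  by_contra! hcon
  have hd : ∀ i, digit (G^[i] p) = 1 := fun i => by
    have h1 := one_le_digit (hp i)
    have h2 := hcon i
    simp only [digits] at h2
    omega
  have hstep : ∀ m, 1 - (G^[2 * m] p).1 = (G^[2 * m] p).2 * (1 - (G^[2 * (m + 1)] p).1) := by
    intro m
    have h := one_sub_fst_eq (hp (2 * m))
      (by rw [← Function.iterate_succ_apply' G]; exact hp _) (hd _)
    rwa [← Function.iterate_succ_apply' G, ← Function.iterate_succ_apply' G] at h
  obtain ⟨h0, h1, h2⟩ := mem_interior_U.1 (hp 0)
  simp only [Function.iterate_zero, id] at h0 h1 h2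
  have hmono : ∀ m, 1 - p.1 ≤ p.1 ^ m * (1 - (G^[2 * m] p).1) := by
    intro m
    induction m with
    | zero => simp
    | succ m ih =>
      obtain ⟨k0, k1, k2⟩ := mem_interior_U.1 (hp (2 * m))
      obtain ⟨l0, l1, l2⟩ := mem_interior_U.1 (hp (2 * (m + 1)))
      have hpm : p.1 ^ m ≤ 1 := pow_le_one₀ (by linarith) h2.le
      have : (G^[2 * m] p).1 ≤ p.1 := by
        nlinarith
      have hb : (G^[2 * m] p).2 ≤ p.1 := by linarith
      calc 1 - p.1 ≤ p.1 ^ m * (1 - (G^[2 * m] p).1) := ih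
        _ = p.1 ^ m * ((G^[2 * m] p).2 * (1 - (G^[2 * (m + 1)] p).1)) := by rw [hstep m]
        _ ≤ p.1 ^ m * (p.1 * (1 - (G^[2 * (m + 1)] p).1)) := by
            have : 0 ≤ p.1 ^ m := pow_nonneg (by linarith) m
            gcongr
        _ = _ := by ring
  obtain ⟨m, hm⟩ := exists_pow_lt_of_lt_one (sub_pos.2 h2) h2
  obtain ⟨k0, k1, k2⟩ := mem_interior_U.1 (hp (2 * m))
  have hle := hmono m
  have : 0 ≤ p.1 ^ m := pow_nonneg (by linarith) m
  nlinarith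

/-- The distance between the first coordinates of two parameters and of their images. -/
noncomputable def fstDist (p q : ℝ × ℝ) : ℝ := max |p.1 - q.1| |(G p).1 - (G q).1|

theorem abs_sub_le_of_mul_eq_one {k x y z x' y' z' : ℝ} (hk : 1 ≤ k)
    (hx : x * (k + y * (1 - z)) = 1) (hx' : x' * (k + y' * (1 - z')) = 1)
    (hy : 0 < y) (hz1 : z < 1) (hy' : 0 < y') (hz1' : z' < 1) :
    (k + y * (1 - z)) * (k + y' * (1 - z')) * |x - x'| ≤
      (1 - (z + z') / 2) * |y - y'| + (y + y') / 2 * |z - z'| := by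
  have hs : 0 < y * (1 - z) := mul_pos hy (by linarith)
  have hs' : 0 < y' * (1 - z') := mul_pos hy' (by linarith)
  have h1 : 0 < (k + y * (1 - z)) * (k + y' * (1 - z')) := by positivity
  have h2 : (k + y * (1 - z)) * (k + y' * (1 - z')) * (x - x') =
      -(1 - (z + z') / 2) * (y - y') + (y + y') / 2 * (z - z') := by
    linear_combination (k + y' * (1 - z')) * hx - (k + y * (1 - z)) * hx'
  calc _ = |(k + y * (1 - z)) * (k + y' * (1 - z')) * (x - x')| := by rw [abs_mul, abs_of_pos h1]
    _ ≤ |-(1 - (z + z') / 2) * (y - y')| + |(y + y') / 2 * (z - z')| := by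
        rw [h2]; exact abs_add_le _ _
    _ = _ := by
        rw [abs_mul, abs_mul, abs_neg, abs_of_nonneg (by linarith : 0 ≤ 1 - (z + z') / 2),
          abs_of_pos (by linarith : 0 < (y + y') / 2)]

theorem fstDist_le {p q : ℝ × ℝ} (hp : p ∈ OmegaInfty) (hq : q ∈ OmegaInfty)
    (hd : digit p = digit q) : fstDist p q ≤ fstDist (G p) (G q) := by
  have hk : (1 : ℝ) ≤ digit p := by exact_mod_cast one_le_digit (hp 0)
  obtain ⟨a0, a1, a2⟩ := mem_interior_U.1 (hp 1)
  obtain ⟨b0, b1, b2⟩ := mem_interior_U.1 (hp 2)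
  obtain ⟨c0, c1, c2⟩ := mem_interior_U.1 (hq 1)
  obtain ⟨d0, d1, d2⟩ := mem_interior_U.1 (hq 2)
  simp only [Function.iterate_succ_apply, Function.iterate_zero, id] at *
  have hx := fst_mul_eq_one (hp 0) (hp 1)
  have hx' := fst_mul_eq_one (hq 0) (hq 1)
  simp only [Function.iterate_zero, id, ← hd] at hx hx'
  have key := abs_sub_le_of_mul_eq_one hk hx hx' (by linarith) (by linarith) (by linarith)
    (by linarith)
  refine max_le ?_ (le_max_left _ _)
  have h1 : |(G p).1 - (G q).1| ≤ fstDist (G p) (G q) := le_max_left _ _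
  have h2 : |(G (G p)).1 - (G (G q)).1| ≤ fstDist (G p) (G q) := le_max_right _ _
  generalize fstDist (G p) (G q) = M at *
  generalize (G p).1 = y at *
  generalize (G q).1 = y' at *
  generalize (G (G p)).1 = z at *
  generalize (G (G q)).1 = z' at *
  have hs : 0 < y * (1 - z) := mul_pos (by linarith) (by linarith)
  have hs' : 0 < y' * (1 - z') := mul_pos (by linarith) (by linarith)
  have hM : 0 ≤ M := (abs_nonneg _).trans h1
  have hyz : y * z ≤ z := by nlinarith
  have hyz' : y' * z' ≤ z' := by nlinarith
  have hw : (1 - (z + z') / 2) + (y + y') / 2 ≤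
      (digit p + y * (1 - z)) * (digit p + y' * (1 - z')) := by
    nlinarith [mul_pos hs hs']
  have hw0 : 0 < (digit p + y * (1 - z)) * (digit p + y' * (1 - z')) := by positivity
  have h3 : (1 - (z + z') / 2) * |y - y'| ≤ (1 - (z + z') / 2) * M :=
    mul_le_mul_of_nonneg_left h1 (by linarith)
  have h4 : (y + y') / 2 * |z - z'| ≤ (y + y') / 2 * M :=
    mul_le_mul_of_nonneg_left h2 (by linarith)
  refine le_of_mul_le_mul_left (key.trans ?_) hw0
  calc _ ≤ ((1 - (z + z') / 2) + (y + y') / 2) * M := by linarith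
    _ ≤ _ := mul_le_mul_of_nonneg_right hw hM

theorem abs_fst_sub_le_half {p q : ℝ × ℝ} (hp : p ∈ OmegaInfty) (hq : q ∈ OmegaInfty)
    (hd : digit p = digit q) (h2 : 2 ≤ digit p) :
    |p.1 - q.1| ≤ 1 / 2 * fstDist (G p) (G q) := by
  have hk : (2 : ℝ) ≤ digit p := by exact_mod_cast h2
  obtain ⟨a0, a1, a2⟩ := mem_interior_U.1 (hp 1)
  obtain ⟨b0, b1, b2⟩ := mem_interior_U.1 (hp 2)
  obtain ⟨c0, c1, c2⟩ := mem_interior_U.1 (hq 1)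
  obtain ⟨d0, d1, d2⟩ := mem_interior_U.1 (hq 2)
  simp only [Function.iterate_succ_apply, Function.iterate_zero, id] at *
  have hx := fst_mul_eq_one (hp 0) (hp 1)
  have hx' := fst_mul_eq_one (hq 0) (hq 1)
  simp only [Function.iterate_zero, id, ← hd] at hx hx'
  have key := abs_sub_le_of_mul_eq_one (by linarith) hx hx' (by linarith) (by linarith)
    (by linarith) (by linarith)
  have h1 : |(G p).1 - (G q).1| ≤ fstDist (G p) (G q) := le_max_left _ _
  have h2 : |(G (G p)).1 - (G (G q)).1| ≤ fstDist (G p) (G q) := le_max_right _ _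
  generalize fstDist (G p) (G q) = M at *
  generalize (G p).1 = y at *
  generalize (G q).1 = y' at *
  generalize (G (G p)).1 = z at *
  generalize (G (G q)).1 = z' at *
  have hs : 0 < y * (1 - z) := mul_pos (by linarith) (by linarith)
  have hs' : 0 < y' * (1 - z') := mul_pos (by linarith) (by linarith)
  have hM : 0 ≤ M := (abs_nonneg _).trans h1
  have hw : 4 ≤ (digit p + y * (1 - z)) * (digit p + y' * (1 - z')) := by nlinarith
  have h3 : (1 - (z + z') / 2) * |y - y'| ≤ 1 * M := by gcongr; linarith
  have h4 : (y + y') / 2 * |z - z'| ≤ 1 * M := by gcongr; linarith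
  have := mul_le_mul_of_nonneg_right hw (abs_nonneg (p.1 - q.1))
  linarith

theorem fst_le_half {p : ℝ × ℝ} (hp : p ∈ OmegaInfty) (h2 : 2 ≤ digit p) : p.1 ≤ 1 / 2 := by
  have h := digit_mul_lt (hp 0) (hp 1)
  have hk : (2 : ℝ) ≤ digit p := by exact_mod_cast h2
  obtain ⟨a0, a1, a2⟩ := mem_interior_U.1 (hp 0)
  simp only [Function.iterate_zero, id] at *
  nlinarith

theorem fstDist_le_of_two_le_digit {p q : ℝ × ℝ} (hp : p ∈ OmegaInfty) (hq : q ∈ OmegaInfty)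
    (hd : digit p = digit q) (hd' : digit (G p) = digit (G q)) (h2 : 2 ≤ digit (G p)) :
    fstDist p q ≤ 3 / 4 * fstDist (G (G p)) (G (G q)) := by
  have hk : (1 : ℝ) ≤ digit p := by exact_mod_cast one_le_digit (hp 0)
  obtain ⟨a0, a1, a2⟩ := mem_interior_U.1 (hp 1)
  obtain ⟨b0, b1, b2⟩ := mem_interior_U.1 (hp 2)
  obtain ⟨c0, c1, c2⟩ := mem_interior_U.1 (hq 1)
  obtain ⟨d0, d1, d2⟩ := mem_interior_U.1 (hq 2)
  have hy2 := fst_le_half (G_mem hp) h2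
  have hy2' := fst_le_half (G_mem hq) (hd' ▸ h2)
  have h1 := abs_fst_sub_le_half (G_mem hp) (G_mem hq) hd' h2
  simp only [Function.iterate_succ_apply, Function.iterate_zero, id] at *
  have hx := fst_mul_eq_one (hp 0) (hp 1)
  have hx' := fst_mul_eq_one (hq 0) (hq 1)
  simp only [Function.iterate_zero, id, ← hd] at hx hx'
  have key := abs_sub_le_of_mul_eq_one hk hx hx' (by linarith) (by linarith) (by linarith)
    (by linarith)
  have h2 : |(G (G p)).1 - (G (G q)).1| ≤ fstDist (G (G p)) (G (G q)) := le_max_left _ _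
  have hM : 0 ≤ fstDist (G (G p)) (G (G q)) := (abs_nonneg _).trans h2
  refine max_le ?_ (by linarith)
  generalize fstDist (G (G p)) (G (G q)) = M at *
  generalize (G p).1 = y at *
  generalize (G q).1 = y' at *
  generalize (G (G p)).1 = z at *
  generalize (G (G q)).1 = z' at *
  have hs : 0 < y * (1 - z) := mul_pos (by linarith) (by linarith)
  have hs' : 0 < y' * (1 - z') := mul_pos (by linarith) (by linarith)
  have hyz : y * z ≤ z / 2 := by nlinarith
  have hyz' : y' * z' ≤ z' / 2 := by nlinarith
  have hw1 : 1 + y * (1 - z) + y' * (1 - z') ≤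
      (digit p + y * (1 - z)) * (digit p + y' * (1 - z')) := by
    nlinarith [mul_pos hs hs']
  have hw : (1 - (z + z') / 2) * (1 / 2) + (y + y') / 2 ≤
      3 / 4 * ((digit p + y * (1 - z)) * (digit p + y' * (1 - z'))) := by
    rcases le_total ((y + y') / 2 - (z + z') / 4) (1 / 4) with h | h <;> linarith
  have hw0 : 0 < (digit p + y * (1 - z)) * (digit p + y' * (1 - z')) := by positivity
  have h3 : (1 - (z + z') / 2) * |y - y'| ≤ (1 - (z + z') / 2) * (1 / 2 * M) :=
    mul_le_mul_of_nonneg_left h1 (by linarith)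
  have h4 : (y + y') / 2 * |z - z'| ≤ (y + y') / 2 * M :=
    mul_le_mul_of_nonneg_left h2 (by linarith)
  refine le_of_mul_le_mul_left (key.trans ?_) hw0
  calc _ ≤ ((1 - (z + z') / 2) * (1 / 2) + (y + y') / 2) * M := by linarith
    _ ≤ _ := mul_le_mul_of_nonneg_right hw hM
    _ = _ := by ring

theorem fstDist_le_iterate {p q : ℝ × ℝ} (hp : p ∈ OmegaInfty) (hq : q ∈ OmegaInfty) (n : ℕ)
    (hd : ∀ i < n, digits q i = digits p i) : fstDist p q ≤ fstDist (G^[n] p) (G^[n] q) := by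
  induction n with
  | zero => rfl
  | succ n ih =>
    refine (ih fun i hi => hd i (by omega)).trans ?_
    rw [Function.iterate_succ_apply', Function.iterate_succ_apply']
    exact fstDist_le (iterate_mem hp n) (iterate_mem hq n) (hd n (by omega)).symm

theorem exists_fstDist_le (r : ℕ) : ∀ {p : ℝ × ℝ}, p ∈ OmegaInfty → ∃ n, ∀ q ∈ OmegaInfty,
    (∀ i < n, digits q i = digits p i) → fstDist p q ≤ (3 / 4) ^ r := by
  induction r with
  | zero =>
    refine fun {p} hp => ⟨0, fun q hq _ => ?_⟩
    obtain ⟨a0, a1, a2⟩ := mem_interior_U.1 (hp 0)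
    obtain ⟨b0, b1, b2⟩ := mem_interior_U.1 (hp 1)
    obtain ⟨c0, c1, c2⟩ := mem_interior_U.1 (hq 0)
    obtain ⟨d0, d1, d2⟩ := mem_interior_U.1 (hq 1)
    simp only [Function.iterate_succ_apply, Function.iterate_zero, id] at *
    rw [pow_zero]
    exact max_le (abs_sub_le_iff.2 ⟨by linarith, by linarith⟩)
      (abs_sub_le_iff.2 ⟨by linarith, by linarith⟩)
  | succ r ih =>
    intro p hp
    obtain ⟨i, hi⟩ := exists_two_le_digits (G_mem hp)
    obtain ⟨n, hn⟩ := ih (iterate_mem hp (i + 2))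
    refine ⟨i + 2 + n, fun q hq hd => ?_⟩
    have h1 := fstDist_le_iterate hp hq i fun j hj => hd j (by omega)
    have h2 := fstDist_le_of_two_le_digit (iterate_mem hp i) (iterate_mem hq i)
      (hd i (by omega)).symm (by
        have := hd (i + 1) (by omega)
        simp only [digits, Function.iterate_succ_apply'] at this
        exact this.symm) (by
        simp only [digits] at hi
        rwa [← Function.iterate_succ_apply, Function.iterate_succ_apply'] at hi)
    have h3 := hn _ (iterate_mem hq (i + 2)) fun j hj => by
      have := hd (j + (i + 2)) (by omega)
      simpa only [digits, Function.iterate_add_apply] using this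
    rw [Function.iterate_succ_apply', Function.iterate_succ_apply',
      Function.iterate_succ_apply', Function.iterate_succ_apply'] at h3
    rw [pow_succ]
    linarith

theorem dist_le_two_mul_fstDist {p q : ℝ × ℝ} (hp : p ∈ OmegaInfty) (hq : q ∈ OmegaInfty) :
    dist q p ≤ 2 * fstDist p q := by
  have h1 : |p.1 - q.1| ≤ fstDist p q := le_max_left _ _
  have h2 : |(G p).1 - (G q).1| ≤ fstDist p q := le_max_right _ _
  have h0 : 0 ≤ fstDist p q := (abs_nonneg _).trans h1
  obtain ⟨b0, b1, b2⟩ := mem_interior_U.1 (hp 1)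
  obtain ⟨c0, c1, c2⟩ := mem_interior_U.1 (hq 0)
  simp only [Function.iterate_succ_apply, Function.iterate_zero, id] at *
  rw [dist_comm, Prod.dist_eq, Real.dist_eq, Real.dist_eq]
  refine max_le (by linarith) ?_
  rw [snd_eq (mem_interior_of_mem hp), snd_eq (mem_interior_of_mem hq)]
  calc |p.1 * (G p).1 - q.1 * (G q).1|
      = |(p.1 - q.1) * (G p).1 + q.1 * ((G p).1 - (G q).1)| := by congr 1; ring
    _ ≤ |(p.1 - q.1) * (G p).1| + |q.1 * ((G p).1 - (G q).1)| := abs_add_le _ _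
    _ = |p.1 - q.1| * (G p).1 + q.1 * |(G p).1 - (G q).1| := by
        rw [abs_mul, abs_mul, abs_of_pos (by linarith : 0 < (G p).1),
          abs_of_pos (by linarith : 0 < q.1)]
    _ ≤ fstDist p q * 1 + 1 * fstDist p q := by gcongr; linarith
    _ = _ := by ring

theorem exists_dist_lt_of_digits_eq {p : ℝ × ℝ} (hp : p ∈ OmegaInfty) {ε : ℝ} (hε : 0 < ε) :
    ∃ n, ∀ q ∈ OmegaInfty, (∀ i < n, digits q i = digits p i) → dist q p < ε := by
  obtain ⟨r, hr⟩ := exists_pow_lt_of_lt_one (half_pos hε) (by norm_num : (3 / 4 : ℝ) < 1)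
  obtain ⟨n, hn⟩ := exists_fstDist_le r hp
  refine ⟨n, fun q hq hd => ?_⟩
  have h1 := hn q hq hd
  have h2 := dist_le_two_mul_fstDist hp hq
  linarith

/-! ### Itineraries and renormalization -/

/-- The translation length of `T_{α,β}` on the partition element with the given symbol. -/
def translation (p : ℝ × ℝ) : Fin 3 → ℝ := ![p.1, p.2, p.2 - 1]

theorem T_eq (p : ℝ × ℝ) (x : ℝ) : T p x = x + translation p (symbol p x) := by
  unfold T symbol translation
  split_ifs <;> simp
  ring

/-- `Path p x u z` says that the itinerary of `x` starts with the word `u`, and that `u` leads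
from `x` to `z`. -/
def Path (p : ℝ × ℝ) : ℝ → List (Fin 3) → ℝ → Prop
  | x, [], z => z = x
  | x, s :: u, z => symbol p x = s ∧ Path p (T p x) u z

theorem path_append {p : ℝ × ℝ} {u w : List (Fin 3)} {x z : ℝ} :
    Path p x (u ++ w) z ↔ ∃ y, Path p x u y ∧ Path p y w z := by
  induction u generalizing x with
  | nil => simp [Path]
  | cons s u ih => simp [Path, ih, and_assoc]

theorem Path.iterate_eq {p : ℝ × ℝ} {u : List (Fin 3)} {x z : ℝ} (h : Path p x u z) :
    (T p)^[u.length] x = z := by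
  induction u generalizing x with
  | nil => exact h.symm
  | cons s u ih => exact ih h.2

theorem Path.sub_eq_sub {p : ℝ × ℝ} {u : List (Fin 3)} {x z x' z' : ℝ} (h : Path p x u z)
    (h' : Path p x' u z') : ∀ t ≤ u.length, (T p)^[t] x' - (T p)^[t] x = x' - x := by
  induction u generalizing x x' with
  | nil =>
    intro t ht
    rw [List.length_nil, Nat.le_zero] at ht
    subst ht
    rfl
  | cons s u ih =>
    rintro (_ | t) ht
    · rfl
    · rw [Function.iterate_succ_apply, Function.iterate_succ_apply,
        ih h.2 h'.2 t (by simpa using ht), T_eq, T_eq, h.1, h'.1]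
      ring

theorem Path.symbol_eq {p : ℝ × ℝ} {u : List (Fin 3)} {x z x' z' : ℝ} (h : Path p x u z)
    (h' : Path p x' u z') :
    ∀ t < u.length, symbol p ((T p)^[t] x) = symbol p ((T p)^[t] x') := by
  induction u generalizing x x' with
  | nil => intro t ht; simp at ht
  | cons s u ih =>
    rintro (_ | t) ht
    · exact h.1.trans h'.1.symm
    · exact ih h.2 h'.2 t (by simpa using ht)

theorem Path.replicate_eq {p : ℝ × ℝ} {s : Fin 3} {j : ℕ} {x z : ℝ}
    (h : Path p x (List.replicate j s) z) : z = x + j * translation p s := by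
  induction j generalizing x with
  | zero => simpa [Path] using h
  | succ j ih =>
    rw [ih h.2, T_eq, h.1]
    push_cast
    ring

theorem path_replicate_zero {p : ℝ × ℝ} (hp : 0 ≤ p.1) (j : ℕ) {x : ℝ}
    (h : x + j * p.1 < 1) : Path p x (List.replicate j 0) (x + j * p.1) := by
  induction j generalizing x with
  | zero => simp [Path]
  | succ j ih =>
    push_cast at h
    have hx : x < 1 - p.1 := by nlinarith [mul_nonneg (Nat.cast_nonneg (α := ℝ) j) hp]
    refine ⟨by simp [symbol, hx], ?_⟩
    have hT : T p x = x + p.1 := by simp [T, hx]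
    rw [hT]
    convert ih (x := x + p.1) (by linarith) using 1
    push_cast
    ring

theorem T_mem_Icc {p : ℝ × ℝ} (hp : p ∈ interior U) {x : ℝ} (hx : x ∈ Set.Icc (0 : ℝ) 1) :
    T p x ∈ Set.Icc (0 : ℝ) 1 := by
  obtain ⟨h0, h1, h2⟩ := mem_interior_U.1 hp
  obtain ⟨hx0, hx1⟩ := hx
  unfold T
  split_ifs <;> constructor <;> linarith

theorem iterate_T_mem_Icc {p : ℝ × ℝ} (hp : p ∈ interior U) (n : ℕ) {x : ℝ}
    (hx : x ∈ Set.Icc (0 : ℝ) 1) : (T p)^[n] x ∈ Set.Icc (0 : ℝ) 1 := by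
  induction n with
  | zero => exact hx
  | succ n ih => rw [Function.iterate_succ_apply']; exact T_mem_Icc hp ih

/-- The words read by the first return map of `T_{α,β}` to `[1 - α, 1]`. -/
def letterWord (k : ℕ) : Fin 3 → List (Fin 3) :=
  ![[1], 2 :: List.replicate k 0, 2 :: List.replicate (k - 1) 0]

/-- The substitution attached to the digit `k`. -/
def subst (k : ℕ) (u : List (Fin 3)) : List (Fin 3) := u.flatMap (letterWord k)

theorem subst_append (k : ℕ) (u w : List (Fin 3)) :
    subst k (u ++ w) = subst k u ++ subst k w := List.flatMap_append

/-- The affine map of `[0, 1]` onto `[1 - l, 1]`. -/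
def lift (l y : ℝ) : ℝ := 1 - l * (1 - y)

theorem path_lift_letter {p : ℝ × ℝ} (hp : p ∈ interior U) (hG : G p ∈ interior U) {y : ℝ}
    (hy : y ∈ Set.Icc (0 : ℝ) 1) :
    Path p (lift p.1 y) (letterWord (digit p) (symbol (G p) y)) (lift p.1 (T (G p) y)) := by
  obtain ⟨h0, h1, h2⟩ := mem_interior_U.1 hp
  obtain ⟨g0, g1, g2⟩ := mem_interior_U.1 hG
  obtain ⟨hy0, hy1⟩ := hy
  have hpos : 0 < p.1 := h0.trans h1
  have hk := one_le_digit hp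
  have hG1 : p.1 * (G p).1 = p.2 := by rw [G_eq hpos]; field_simp
  have hG2 : p.1 * (G p).2 = p.2 - 1 + digit p * p.1 := by rw [G_eq hpos]; field_simp
  have hlow : ¬ lift p.1 y < 1 - p.1 := by unfold lift; nlinarith
  have hsub : ((digit p - 1 : ℕ) : ℝ) = digit p - 1 := by push_cast [Nat.cast_sub hk]; ring
  unfold symbol
  split_ifs with hs1 hs2
  · have hmid : lift p.1 y < 1 - p.2 := by unfold lift; nlinarith
    have hT : T (G p) y = y + (G p).1 := by simp [T, hs1]
    rw [hT]
    refine ⟨by simp [symbol, hlow, hmid], ?_⟩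
    simp only [Path, T, if_neg hlow, if_pos hmid]
    unfold lift
    linarith
  · have hmid : ¬ lift p.1 y < 1 - p.2 := by unfold lift; nlinarith
    have hT : T (G p) y = y + (G p).2 := by simp [T, hs1, hs2]
    rw [hT]
    refine ⟨by simp [symbol, hlow, hmid], ?_⟩
    have hT' : T p (lift p.1 y) = lift p.1 y - 1 + p.2 := by simp [T, hlow, hmid]
    have hend : lift p.1 (y + (G p).2) = lift p.1 y - 1 + p.2 + digit p * p.1 := by
      unfold lift; linarith
    rw [hT', hend]
    refine path_replicate_zero hpos.le _ ?_
    rw [← hend]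
    unfold lift
    nlinarith
  · have hmid : ¬ lift p.1 y < 1 - p.2 := by unfold lift; nlinarith
    have hT : T (G p) y = y - 1 + (G p).2 := by simp [T, hs1, hs2]
    rw [hT]
    refine ⟨by simp [symbol, hlow, hmid], ?_⟩
    have hT' : T p (lift p.1 y) = lift p.1 y - 1 + p.2 := by simp [T, hlow, hmid]
    have hend : lift p.1 (y - 1 + (G p).2) =
        lift p.1 y - 1 + p.2 + (digit p - 1 : ℕ) * p.1 := by
      rw [hsub]; unfold lift; linarith
    rw [hT', hend]
    refine path_replicate_zero hpos.le _ ?_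
    rw [← hend]
    unfold lift
    nlinarith

theorem Path.lift {p : ℝ × ℝ} (hp : p ∈ interior U) (hG : G p ∈ interior U)
    {u : List (Fin 3)} {y z : ℝ} (hy : y ∈ Set.Icc (0 : ℝ) 1) (h : Path (G p) y u z) :
    Path p (lift p.1 y) (subst (digit p) u) (ITM.lift p.1 z) := by
  induction u generalizing y with
  | nil => simpa [Path, subst] using congrArg (ITM.lift p.1) h
  | cons s u ih =>
    rw [subst, List.flatMap_cons, path_append]
    refine ⟨_, ?_, ih (T_mem_Icc hG hy) h.2⟩
    rw [← h.1]
    exact path_lift_letter hp hG hy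

/-- The composition of the first `n` substitutions of a digit sequence. -/
def iterSubst (d : ℕ → ℕ) : ℕ → List (Fin 3) → List (Fin 3)
  | 0, u => u
  | n + 1, u => iterSubst d n (subst (d n) u)

theorem iterSubst_append (d : ℕ → ℕ) (n : ℕ) (u w : List (Fin 3)) :
    iterSubst d n (u ++ w) = iterSubst d n u ++ iterSubst d n w := by
  induction n generalizing u w with
  | zero => rfl
  | succ n ih => simp only [iterSubst, subst_append, ih]

theorem iterSubst_nil (d : ℕ → ℕ) (n : ℕ) : iterSubst d n [] = [] := by
  have := congrArg List.length (iterSubst_append d n [] [])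
  rw [List.append_nil, List.length_append] at this
  exact List.length_eq_zero_iff.1 (by omega)

theorem iterSubst_congr {d e : ℕ → ℕ} {n : ℕ} (h : ∀ i < n, d i = e i) (u : List (Fin 3)) :
    iterSubst d n u = iterSubst e n u := by
  induction n generalizing u with
  | zero => rfl
  | succ n ih =>
    simp only [iterSubst, h n (by omega)]
    exact ih (fun i hi => h i (by omega)) _

/-- The length of the word read by the `n`-th induced map on a letter: a return time. -/
def height (d : ℕ → ℕ) (n : ℕ) (s : Fin 3) : ℕ := (iterSubst d n [s]).length

theorem length_iterSubst_replicate (d : ℕ → ℕ) (n j : ℕ) (s : Fin 3) :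
    (iterSubst d n (List.replicate j s)).length = j * height d n s := by
  induction j with
  | zero => simp [iterSubst_nil]
  | succ j ih =>
    rw [List.replicate_succ', iterSubst_append, List.length_append, ih, height]
    ring

theorem length_iterSubst_cons (d : ℕ → ℕ) (n : ℕ) (s : Fin 3) (u : List (Fin 3)) :
    (iterSubst d n (s :: u)).length = height d n s + (iterSubst d n u).length := by
  rw [← List.singleton_append, iterSubst_append, List.length_append, height]

theorem height_succ_zero (d : ℕ → ℕ) (n : ℕ) : height d (n + 1) 0 = height d n 1 := rfl

theorem height_succ_one (d : ℕ → ℕ) (n : ℕ) :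
    height d (n + 1) 1 = height d n 2 + d n * height d n 0 := by
  rw [← length_iterSubst_replicate, ← length_iterSubst_cons]
  simp [height, iterSubst, subst, letterWord]

theorem height_succ_two (d : ℕ → ℕ) (n : ℕ) :
    height d (n + 1) 2 = height d n 2 + (d n - 1) * height d n 0 := by
  rw [← length_iterSubst_replicate, ← length_iterSubst_cons]
  simp [height, iterSubst, subst, letterWord]

theorem height_pos (d : ℕ → ℕ) (n : ℕ) (s : Fin 3) : 0 < height d n s := by
  induction n generalizing s with
  | zero => simp [height, iterSubst]
  | succ n ih =>
    fin_cases s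
    · exact ih 1
    · exact (height_succ_one d n).symm ▸ Nat.add_pos_left (ih 2) _
    · exact (height_succ_two d n).symm ▸ Nat.add_pos_left (ih 2) _

theorem eq_one_of_dvd_height {d : ℕ → ℕ} {n : ℕ} (hd : ∀ i < n, 1 ≤ d i) {g : ℕ}
    (h : ∀ s, g ∣ height d n s) : g = 1 := by
  induction n with
  | zero => simpa [height, iterSubst] using h 0
  | succ n ih =>
    refine ih (fun i hi => hd i (by omega)) ?_
    have h0 := h 0
    have h1 := h 1
    have h2 := h 2
    rw [height_succ_zero] at h0
    rw [height_succ_one] at h1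
    rw [height_succ_two] at h2
    obtain ⟨k, hk⟩ : ∃ k, d n = k + 1 := ⟨d n - 1, by have := hd n (by omega); omega⟩
    rw [hk] at h1 h2
    rw [add_tsub_cancel_right] at h2
    have ha : g ∣ height d n 0 := by
      rw [add_mul, one_mul, ← add_assoc] at h1
      exact (Nat.dvd_add_right h2).1 h1
    have hc : g ∣ height d n 2 := (Nat.dvd_add_left (ha.mul_left k)).1 h2
    intro s
    fin_cases s
    · exact ha
    · exact h0
    · exact hc

theorem exists_coprime_add_mul {a b c : ℕ} (hb : b ≠ 0) (h : ∀ g, g ∣ a → g ∣ b → g ∣ c → g = 1) :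
    ∃ k, 1 ≤ k ∧ Nat.Coprime b (c + k * a) := by
  refine ⟨∏ q ∈ b.primeFactors.filter (fun q => ¬ q ∣ c), q, ?_, ?_⟩
  · exact Finset.prod_pos fun q hq =>
      (Nat.prime_of_mem_primeFactors (Finset.mem_filter.1 hq).1).pos
  · refine Nat.coprime_of_dvd fun q hq hqb hqs => ?_
    by_cases hqc : q ∣ c
    · rcases (hq.dvd_mul).1 ((Nat.dvd_add_right hqc).1 hqs) with hk | ha
      · obtain ⟨r, hr, hqr⟩ := (hq.prime.dvd_finsetProd_iff _).1 hk
        rw [Finset.mem_filter] at hr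
        rw [(Nat.prime_dvd_prime_iff_eq hq (Nat.prime_of_mem_primeFactors hr.1)).1 hqr] at hqc
        exact hr.2 hqc
      · exact hq.one_lt.ne' (h q ha hqb hqc)
    · have hk : q ∣ ∏ q ∈ b.primeFactors.filter (fun q => ¬ q ∣ c), q :=
        Finset.dvd_prod_of_mem _
          (Finset.mem_filter.2 ⟨Nat.mem_primeFactors.2 ⟨hq, hqb, hb⟩, hqc⟩)
      exact hqc ((Nat.dvd_add_left (hk.mul_right a)).1 hqs)

/-- The length of the domain of the `n`-th induced map. -/
noncomputable def scale (p : ℝ × ℝ) (n : ℕ) : ℝ := ∏ i ∈ Finset.range n, (G^[i] p).1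

theorem scale_mem {p : ℝ × ℝ} (hp : p ∈ OmegaInfty) (n : ℕ) : scale p n ∈ Set.Icc (0 : ℝ) 1 := by
  have h : ∀ i, 0 ≤ (G^[i] p).1 ∧ (G^[i] p).1 ≤ 1 := fun i => by
    obtain ⟨h0, h1, h2⟩ := mem_interior_U.1 (hp i)
    exact ⟨by linarith, h2.le⟩
  exact ⟨Finset.prod_nonneg fun i _ => (h i).1,
    Finset.prod_le_one (fun i _ => (h i).1) fun i _ => (h i).2⟩

theorem lift_mem_Icc {l y : ℝ} (hl : l ∈ Set.Icc (0 : ℝ) 1) (hy : y ∈ Set.Icc (0 : ℝ) 1) :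
    lift l y ∈ Set.Icc (0 : ℝ) 1 := by
  obtain ⟨a, b⟩ := hl
  obtain ⟨c, d⟩ := hy
  unfold lift
  constructor <;> nlinarith

theorem lift_scale_succ (p : ℝ × ℝ) (n : ℕ) (y : ℝ) :
    lift (scale p (n + 1)) y = lift (scale p n) (lift (G^[n] p).1 y) := by
  simp only [lift, scale, Finset.prod_range_succ]
  ring

theorem fst_mem_Icc {p : ℝ × ℝ} (hp : p ∈ interior U) : p.1 ∈ Set.Icc (0 : ℝ) 1 := by
  obtain ⟨h0, h1, h2⟩ := mem_interior_U.1 hp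
  exact ⟨by linarith, h2.le⟩

theorem Path.lift_subst {p : ℝ × ℝ} (hp : p ∈ OmegaInfty) {n : ℕ} {u : List (Fin 3)} {y z : ℝ}
    (hy : y ∈ Set.Icc (0 : ℝ) 1) (h : Path (G^[n + 1] p) y u z) :
    Path (G^[n] p) (ITM.lift (G^[n] p).1 y) (subst (digits p n) u) (ITM.lift (G^[n] p).1 z) := by
  have hn := hp (n + 1)
  rw [Function.iterate_succ_apply'] at h hn
  exact Path.lift (hp n) hn hy h

theorem Path.lift_iterSubst {p : ℝ × ℝ} (hp : p ∈ OmegaInfty) {n : ℕ} {u : List (Fin 3)} {y z : ℝ}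
    (hy : y ∈ Set.Icc (0 : ℝ) 1) (h : Path (G^[n] p) y u z) :
    Path p (ITM.lift (scale p n) y) (iterSubst (digits p) n u) (ITM.lift (scale p n) z) := by
  induction n generalizing u y z with
  | zero => simpa [ITM.lift, scale, iterSubst] using h
  | succ n ih =>
    rw [lift_scale_succ, lift_scale_succ]
    exact ih (lift_mem_Icc (fst_mem_Icc (hp n)) hy) (h.lift_subst hp hy)

theorem path_singleton (p : ℝ × ℝ) (x : ℝ) : Path p x [symbol p x] (T p x) := ⟨rfl, rfl⟩

/-- Every point of `[0, 1]` reaches the domain of the `n`-th induced map in bounded time. -/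
theorem exists_iterate_mem_lift {p : ℝ × ℝ} (hp : p ∈ OmegaInfty) (n : ℕ) :
    ∃ R : ℕ, ∀ x ∈ Set.Icc (0 : ℝ) 1, ∃ t ≤ R, (T p)^[t] x ∈ lift (scale p n) '' Set.Icc 0 1 := by
  induction n with
  | zero =>
    refine ⟨0, fun x hx => ⟨0, le_rfl, x, hx, ?_⟩⟩
    simp [lift, scale]
  | succ n ih =>
    obtain ⟨R, hR⟩ := ih
    obtain ⟨h0, h1, h2⟩ := mem_interior_U.1 (hp n)
    set a := (G^[n] p).1 with ha
    have ha0 : 0 < a := h0.trans h1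
    refine ⟨⌈1 / a⌉₊ * height (digits p) n 0 + R, fun x hx => ?_⟩
    obtain ⟨t, ht, y, hy, hxy⟩ := hR x hx
    obtain ⟨j, hj, hj1, hj2, hj3⟩ : ∃ j : ℕ, j ≤ ⌈1 / a⌉₊ ∧ 1 - a ≤ y + j * a ∧ y + j * a ≤ 1 ∧
        Path (G^[n] p) y (List.replicate j 0) (y + j * a) := by
      by_cases hya : y < 1 - a
      · have hq : 0 < (1 - a - y) / a := div_pos (by linarith) ha0
        have hle := Nat.le_ceil ((1 - a - y) / a)
        have hlt := Nat.ceil_lt_add_one hq.le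
        rw [div_le_iff₀ ha0] at hle
        rw [← sub_lt_iff_lt_add, lt_div_iff₀ ha0] at hlt
        refine ⟨⌈(1 - a - y) / a⌉₊, Nat.ceil_mono ?_, by linarith, by linarith,
          path_replicate_zero ha0.le _ (by linarith)⟩
        have := hy.1
        gcongr
        linarith
      · exact ⟨0, Nat.zero_le _, by push_cast; linarith, by simpa using hy.2, by simp [Path]⟩
    refine ⟨j * height (digits p) n 0 + t, by gcongr, 1 - (1 - (y + j * a)) / a, ⟨?_, ?_⟩, ?_⟩
    · rw [sub_nonneg, div_le_one ha0]; linarith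
    · rw [sub_le_self_iff]; exact div_nonneg (by linarith) ha0.le
    · rw [Function.iterate_add_apply, ← hxy, ← length_iterSubst_replicate,
        (hj3.lift_iterSubst hp hy).iterate_eq, lift_scale_succ]
      congr 1
      rw [← ha]
      unfold lift
      field_simp
      ring

/-! ### Birkhoff sums bounded from below -/

theorem neg_le_birkhoffSum {X : Type*} {f : X → X} {g : X → ℝ} (hg : ∀ x, -1 ≤ g x) (m : ℕ)
    (x : X) : -(m : ℝ) ≤ birkhoffSum f g m x := by
  have := Finset.card_nsmul_le_sum (Finset.range m) (fun i => g (f^[i] x)) (-1) fun i _ => hg _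
  simpa [birkhoffSum] using this

theorem neg_le_birkhoffSum_of_return {X : Type*} {f : X → X} {g : X → ℝ} (hg : ∀ x, -1 ≤ g x)
    {B Y : Set X} {M R : ℕ}
    (hB : ∀ x ∈ B, ∃ h, 0 < h ∧ h ≤ M ∧ f^[h] x ∈ B ∧ 0 ≤ birkhoffSum f g h x)
    (hY : ∀ x ∈ Y, ∃ t ≤ R, f^[t] x ∈ B) :
    ∀ x ∈ Y, ∀ m, -((R + M : ℕ) : ℝ) ≤ birkhoffSum f g m x := by
  have hmain : ∀ m, ∀ x ∈ B, -(M : ℝ) ≤ birkhoffSum f g m x := by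
    intro m
    induction m using Nat.strong_induction_on with
    | _ m ih =>
      intro x hx
      obtain ⟨h, h0, hM, hxB, hs⟩ := hB x hx
      rcases lt_or_ge m h with hlt | hge
      · have h1 := neg_le_birkhoffSum (f := f) hg m x
        have h2 : (m : ℝ) ≤ M := by exact_mod_cast hlt.le.trans hM
        linarith
      · obtain ⟨r, rfl⟩ := Nat.exists_eq_add_of_le hge
        rw [birkhoffSum_add]
        have := ih r (by omega) _ hxB
        linarith
  intro x hx m
  obtain ⟨t, ht, hxB⟩ := hY x hx
  have htR : (t : ℝ) ≤ R := by exact_mod_cast ht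
  push_cast
  rcases lt_or_ge m t with hlt | hge
  · have h1 := neg_le_birkhoffSum (f := f) hg m x
    have h2 : (m : ℝ) ≤ t := by exact_mod_cast hlt.le
    have h3 : (0 : ℝ) ≤ M := Nat.cast_nonneg _
    linarith
  · obtain ⟨r, rfl⟩ := Nat.exists_eq_add_of_le hge
    rw [birkhoffSum_add]
    have h1 := neg_le_birkhoffSum (f := f) hg t x
    have h2 := hmain r _ hxB
    linarith

theorem le_birkhoffSum_indicator {X : Type*} {f : X → X} {A : Set X} {c m r : ℕ} {x : X}
    (h : ∀ t < m, f^[t] (f^[c] x) ∈ A) :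
    (m : ℝ) ≤ birkhoffSum f (A.indicator 1) (c + m + r) x := by
  have hnn : ∀ n y, 0 ≤ birkhoffSum f (A.indicator (1 : X → ℝ)) n y := fun n y =>
    Finset.sum_nonneg fun i _ => Set.indicator_nonneg (fun _ _ => zero_le_one) _
  have hm : birkhoffSum f (A.indicator (1 : X → ℝ)) m (f^[c] x) = m := by
    rw [birkhoffSum, Finset.sum_congr rfl fun t ht =>
      Set.indicator_of_mem (h t (Finset.mem_range.1 ht)) _]
    simp
  rw [birkhoffSum_add, birkhoffSum_add, hm]
  linarith [hnn c x, hnn r (f^[c + m] x)]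

/-- The points whose `T_{α,β}`-orbit almost repeats itself after time `a`. -/
def recurrenceSet (p : ℝ × ℝ) (a M : ℕ) : Set ℝ :=
  {x | |(T p)^[a] x - x| ≤ 1 / (M + 1) ∧
    ∀ t < M, symbol p ((T p)^[t] x) = symbol p ((T p)^[t] ((T p)^[a] x))}

/-- The indicator function of `A`, minus `1/10`. -/
noncomputable def visitExcess (A : Set ℝ) (x : ℝ) : ℝ := A.indicator 1 x - 1 / 10

/-- The orbits of all points of `[0, 1]` visit `A` with lower frequency at least `1/10`. -/
def FrequentlyVisits (p : ℝ × ℝ) (A : Set ℝ) : Prop :=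
  ∃ C : ℝ, ∀ x ∈ Set.Icc (0 : ℝ) 1, ∀ m,
    -C ≤ birkhoffSum (T p) (visitExcess A) m x

theorem iterate_mem_recurrenceSet {p : ℝ × ℝ} (hp : p ∈ OmegaInfty) {n : ℕ} {y y' : ℝ}
    (hy : y ∈ Set.Icc (0 : ℝ) 1) {b : Fin 3} {j r M : ℕ}
    (h : Path (G^[n] p) y (List.replicate (j + r) b) y')
    (hdisp : |j * translation (G^[n] p) b| ≤ 1 / (M + 1)) {t : ℕ}
    (ht : t + M ≤ r * height (digits p) n b) :
    (T p)^[t] (lift (scale p n) y) ∈ recurrenceSet p (j * height (digits p) n b) M := by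
  have h' := h
  rw [List.replicate_add, path_append] at h
  rw [Nat.add_comm, List.replicate_add, path_append] at h'
  obtain ⟨z, hyz, hz⟩ := h
  obtain ⟨w, hyw, -⟩ := h'
  have hzI : z ∈ Set.Icc (0 : ℝ) 1 := by
    rw [← hyz.iterate_eq]
    exact iterate_T_mem_Icc (hp n) _ hy
  have hzy := hyz.replicate_eq
  have hT := (hyz.lift_iterSubst hp hy).iterate_eq
  rw [length_iterSubst_replicate] at hT
  have h1 := hyw.lift_iterSubst hp hy
  have h2 := hz.lift_iterSubst hp hzI
  have hlen := length_iterSubst_replicate (digits p) n r b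
  have hcomm : (T p)^[j * height (digits p) n b] ((T p)^[t] (lift (scale p n) y)) =
      (T p)^[t] (lift (scale p n) z) := by
    rw [← Function.iterate_add_apply, Nat.add_comm, Function.iterate_add_apply, hT]
  obtain ⟨l0, l1⟩ := scale_mem hp n
  refine ⟨?_, fun i hi => ?_⟩
  · rw [hcomm, h1.sub_eq_sub h2 t (by omega)]
    have : lift (scale p n) z - lift (scale p n) y = scale p n * (j * translation (G^[n] p) b) := by
      unfold lift
      linear_combination scale p n * hzy
    rw [this, abs_mul, abs_of_nonneg l0]
    exact (mul_le_of_le_one_left (abs_nonneg _) l1).trans hdisp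
  · rw [hcomm, ← Function.iterate_add_apply, ← Function.iterate_add_apply]
    exact h1.symbol_eq h2 (i + t) (by omega)

theorem frequentlyVisits_recurrenceSet {p : ℝ × ℝ} (hp : p ∈ OmegaInfty) {n : ℕ} {b : Fin 3}
    {j r M : ℕ}
    (hdec : ∀ s, ∃ u w, subst (digits p n) (subst (digits p (n + 1)) (subst (digits p (n + 2)) [s]))
      = u ++ (List.replicate (j + r) b ++ w))
    (hdisp : |j * translation (G^[n] p) b| ≤ 1 / (M + 1))
    (hcount : ∀ s, height (digits p) (n + 3) s + 10 * M ≤ 10 * (r * height (digits p) n b)) :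
    FrequentlyVisits p (recurrenceSet p (j * height (digits p) n b) M) := by
  obtain ⟨R, hR⟩ := exists_iterate_mem_lift hp (n + 3)
  set A := recurrenceSet p (j * height (digits p) n b) M with hA
  refine ⟨_, neg_le_birkhoffSum_of_return (M := ∑ s, height (digits p) (n + 3) s) ?_ ?_ hR⟩
  · intro x
    have : 0 ≤ A.indicator (1 : ℝ → ℝ) x := Set.indicator_nonneg (fun _ _ => zero_le_one) _
    unfold visitExcess
    linarith
  rintro _ ⟨y, hy, rfl⟩
  set s := symbol (G^[n + 3] p) y with hs
  have hpath := path_singleton (G^[n + 3] p) y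
  rw [← hs] at hpath
  have hret := (hpath.lift_iterSubst hp hy).iterate_eq
  refine ⟨height (digits p) (n + 3) s, height_pos _ _ _,
    Finset.single_le_sum (f := height (digits p) (n + 3)) (fun _ _ => Nat.zero_le _)
      (Finset.mem_univ s), ?_, ?_⟩
  · rw [height, hret]
    exact ⟨_, T_mem_Icc (hp _) hy, rfl⟩
  · obtain ⟨u, w, huw⟩ := hdec s
    have hy2 := lift_mem_Icc (fst_mem_Icc (hp (n + 2))) hy
    have hy1 := lift_mem_Icc (fst_mem_Icc (hp (n + 1))) hy2
    have hy0 := lift_mem_Icc (fst_mem_Icc (hp n)) hy1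
    have hlev := ((hpath.lift_subst hp hy).lift_subst hp hy2).lift_subst hp hy1
    rw [huw, path_append] at hlev
    obtain ⟨y1, hu, hrest⟩ := hlev
    rw [path_append] at hrest
    obtain ⟨y2, hrep, -⟩ := hrest
    have hy1I : y1 ∈ Set.Icc (0 : ℝ) 1 := by
      rw [← hu.iterate_eq]
      exact iterate_T_mem_Icc (hp n) _ hy0
    have hstart := (hu.lift_iterSubst hp hy0).iterate_eq
    rw [← lift_scale_succ, ← lift_scale_succ, ← lift_scale_succ] at hstart
    have hlen : height (digits p) (n + 3) s = (iterSubst (digits p) n u).length +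
        ((j + r) * height (digits p) n b + (iterSubst (digits p) n w).length) := by
      rw [← length_iterSubst_replicate, ← List.length_append, ← List.length_append,
        ← iterSubst_append, ← iterSubst_append, ← huw]
      rfl
    have hc := hcount s
    set v := height (digits p) n b with hv
    have hle := le_birkhoffSum_indicator (f := T p) (A := A)
      (c := (iterSubst (digits p) n u).length) (m := r * v - M)
      (r := M + j * v + (iterSubst (digits p) n w).length)
      (x := lift (scale p (n + 3)) y) fun t ht => by
        rw [hstart]
        exact iterate_mem_recurrenceSet hp hy1I hrep hdisp (by rw [← hv]; omega)
    have hsum : (iterSubst (digits p) n u).length + (r * v - M) +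
        (M + j * v + (iterSubst (digits p) n w).length) = height (digits p) (n + 3) s := by
      rw [hlen, add_mul]
      omega
    rw [hsum] at hle
    have hcast : (height (digits p) (n + 3) s : ℝ) ≤ 10 * ((r * v - M : ℕ) : ℝ) := by
      exact_mod_cast (by omega : height (digits p) (n + 3) s ≤ 10 * (r * v - M))
    have hsplit : birkhoffSum (T p) (visitExcess A)
        (height (digits p) (n + 3) s) (lift (scale p (n + 3)) y) =
        birkhoffSum (T p) (A.indicator 1) (height (digits p) (n + 3) s)
          (lift (scale p (n + 3)) y) - height (digits p) (n + 3) s * (1 / 10) := by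
      simp [birkhoffSum, visitExcess]
    rw [hsplit]
    linarith

/-! ### The generic digit sequences -/

/-- The size parameter in `GoodAt`. -/
def repetition (d : ℕ → ℕ) (n : ℕ) : ℕ := height d n 2 + 2 * n + 4

/-- At level `n`, long repetitions of two words of coprime lengths take comparable times. -/
def GoodAt (d : ℕ → ℕ) (n : ℕ) : Prop :=
  Nat.Coprime (height d n 0) (height d n 1) ∧ d n = repetition d n * height d n 1 ∧
    d (n + 1) = repetition d n * height d n 0 ∧ d (n + 2) = 1

theorem height_congr {d e : ℕ → ℕ} {n : ℕ} (h : ∀ i < n, d i = e i) (s : Fin 3) :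
    height d n s = height e n s := by
  rw [height, iterSubst_congr h, height]

theorem goodAt_congr {d e : ℕ → ℕ} {n : ℕ} (h : ∀ i < n + 3, d i = e i) (hd : GoodAt d n) :
    GoodAt e n := by
  have hh := height_congr (d := d) (e := e) (n := n) fun i hi => h i (by omega)
  unfold GoodAt repetition at *
  rwa [hh, hh, hh, h n (by omega), h (n + 1) (by omega), h (n + 2) (by omega)] at hd

theorem subst_subst_subst_one (k l : ℕ) (s : Fin 3) :
    subst (k + 1) (subst (l + 1) (subst 1 [s])) =
      [2] ++ (List.replicate k 0 ++ (List.replicate l 1 ++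
        ![[1], 2 :: List.replicate (k + 1) 0, []] s)) := by
  have h : ∀ m, subst (k + 1) (List.replicate m 0) = List.replicate m 1 := by
    intro m
    induction m with
    | zero => rfl
    | succ m ih => rw [List.replicate_succ, subst, List.flatMap_cons, ← subst, ih]; rfl
  have h2 : subst (k + 1) [2] = 2 :: List.replicate k 0 := by simp [subst, letterWord]
  fin_cases s
  · change subst (k + 1) ([2] ++ (List.replicate (l + 1) 0 ++ [])) = _
    rw [List.append_nil, subst_append, h, h2, List.replicate_succ']
    simp
  · change subst (k + 1) ([2] ++ List.replicate l 0 ++ [1]) = _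
    rw [subst_append, subst_append, h, h2]
    simp [subst, letterWord]
  · change subst (k + 1) ([2] ++ (List.replicate l 0 ++ [])) = _
    rw [List.append_nil, subst_append, h, h2]
    simp

theorem exists_mul_eq_mul_add_one {v w : ℕ} (hw : 0 < w) (hv : 0 < v) (h : Nat.Coprime v w) :
    ∃ i j, i ≤ v ∧ j ≤ w ∧ j * v = i * w + 1 := by
  rcases Nat.lt_or_ge 1 w with h1 | h1
  · obtain ⟨m, hlt, hm⟩ := Nat.exists_mul_mod_eq_one_of_coprime h h1
    have hdiv := Nat.div_add_mod (v * m) w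
    rw [hm] at hdiv
    refine ⟨v * m / w, m, ?_, hlt.le, ?_⟩
    · exact Nat.div_le_of_le_mul (by rw [Nat.mul_comm w]; gcongr)
    · rw [Nat.mul_comm, Nat.mul_comm _ w, hdiv]
  · obtain rfl : w = 1 := by omega
    exact ⟨v - 1, 1, by omega, le_rfl, by omega⟩

theorem height_add_three_le {d : ℕ → ℕ} {n : ℕ} (h : GoodAt d n) (s : Fin 3) :
    height d (n + 3) s ≤ 5 * (repetition d n * (height d n 0 * height d n 1)) := by
  obtain ⟨-, hK, hL, h1⟩ := h
  have hv := height_pos d n 0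
  have hw := height_pos d n 1
  have hN : height d n 2 ≤ repetition d n := by unfold repetition; omega
  have hN0 : 1 ≤ repetition d n := by unfold repetition; omega
  have e0 : height d (n + 3) 0 =
      height d n 2 + (d n - 1) * height d n 0 + d (n + 1) * height d n 1 := by
    rw [height_succ_zero, height_succ_one, height_succ_two, height_succ_zero]
  have e1 : height d (n + 3) 1 = height d n 2 + (d n - 1) * height d n 0 +
      (d (n + 1) - 1) * height d n 1 + (height d n 2 + d n * height d n 0) := by
    rw [height_succ_one, height_succ_two, height_succ_two, height_succ_zero, height_succ_zero,
      height_succ_one, h1, one_mul]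
  have e2 : height d (n + 3) 2 = height d n 2 + (d n - 1) * height d n 0 +
      (d (n + 1) - 1) * height d n 1 := by
    rw [height_succ_two, height_succ_two, height_succ_two, height_succ_zero, height_succ_zero, h1]
    simp
  have hKv : d n * height d n 0 = repetition d n * (height d n 0 * height d n 1) := by
    rw [hK]; ring
  have hLw : d (n + 1) * height d n 1 = repetition d n * (height d n 0 * height d n 1) := by
    rw [hL]; ring
  have hKv' : (d n - 1) * height d n 0 ≤ d n * height d n 0 :=
    Nat.mul_le_mul_right _ (Nat.sub_le _ _)
  have hLw' : (d (n + 1) - 1) * height d n 1 ≤ d (n + 1) * height d n 1 :=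
    Nat.mul_le_mul_right _ (Nat.sub_le _ _)
  have hc : height d n 2 ≤ repetition d n * (height d n 0 * height d n 1) :=
    hN.trans (Nat.le_mul_of_pos_right _ (Nat.mul_pos hv hw))
  fin_cases s
  · change height d (n + 3) 0 ≤ _; omega
  · change height d (n + 3) 1 ≤ _; omega
  · change height d (n + 3) 2 ≤ _; omega

theorem height_add_le_of_goodAt {d : ℕ → ℕ} {n : ℕ} (h : GoodAt d n) (s : Fin 3)
    {v w j r : ℕ} (hvw : v * w = height d n 0 * height d n 1) (hj : j ≤ w) (hw : 0 < w)
    (hr : j + r + 1 = repetition d n * w) :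
    height d (n + 3) s + 10 * n ≤ 10 * (r * v) := by
  have h5 := height_add_three_le h s
  rw [← hvw] at h5
  have hP : 0 < v * w := hvw ▸ Nat.mul_pos (height_pos d n 0) (height_pos d n 1)
  have hN : 2 * n + 4 ≤ repetition d n := by unfold repetition; omega
  have hNP : (2 * n + 4) * (v * w) ≤ repetition d n * (v * w) := Nat.mul_le_mul_right _ hN
  have hrv : (j + r + 1) * v = repetition d n * (v * w) := by rw [hr]; ring
  have hjv : j * v ≤ v * w := by rw [Nat.mul_comm v]; gcongr
  have hv1 : v ≤ v * w := Nat.le_mul_of_pos_right _ hw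
  have hn : n ≤ n * (v * w) := Nat.le_mul_of_pos_right _ hP
  rw [add_mul, add_mul, one_mul] at hrv
  rw [add_mul, mul_assoc] at hNP
  omega

theorem exists_frequentlyVisits {p : ℝ × ℝ} (hp : p ∈ OmegaInfty) {n : ℕ}
    (h : GoodAt (digits p) n) :
    ∃ a, FrequentlyVisits p (recurrenceSet p a n) ∧
      FrequentlyVisits p (recurrenceSet p (a + 1) n) := by
  have hv := height_pos (digits p) n 0
  have hw := height_pos (digits p) n 1
  obtain ⟨i, j, hi, hj, hij⟩ := exists_mul_eq_mul_add_one hw hv h.1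
  obtain ⟨-, hK, hL, h1⟩ := id h
  have hN : 2 * n + 4 ≤ repetition (digits p) n := by unfold repetition; omega
  have hNw : 4 * height (digits p) n 1 ≤ repetition (digits p) n * height (digits p) n 1 :=
    Nat.mul_le_mul_right _ (by omega)
  have hNv : 4 * height (digits p) n 0 ≤ repetition (digits p) n * height (digits p) n 0 :=
    Nat.mul_le_mul_right _ (by omega)
  obtain ⟨k, hk⟩ : ∃ k, digits p n = j + k + 1 := ⟨digits p n - 1 - j, by omega⟩
  obtain ⟨l, hl⟩ : ∃ l, digits p (n + 1) = i + l + 1 := ⟨digits p (n + 1) - 1 - i, by omega⟩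
  have hword : ∀ s,
      subst (digits p n) (subst (digits p (n + 1)) (subst (digits p (n + 2)) [s])) = _ :=
    fun s => by rw [hk, hl, h1, subst_subst_subst_one]
  obtain ⟨a0, a1, a2⟩ := mem_interior_U.1 (hp n)
  obtain ⟨b0, b1, b2⟩ := mem_interior_U.1 (hp (n + 1))
  have hNR : ((n : ℝ) + 1) ≤ repetition (digits p) n := by
    exact_mod_cast (by omega : n + 1 ≤ repetition (digits p) n)
  have hsucc : ∀ m, G (G^[m] p) ∈ interior U := fun m => by
    rw [← Function.iterate_succ_apply' G]; exact hp _
  refine ⟨i * height (digits p) n 1, ?_, hij ▸ ?_⟩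
  · refine frequentlyVisits_recurrenceSet hp (r := l) (fun s => ⟨_, _, (hword s).trans
      (List.append_assoc _ _ _).symm⟩) ?_ fun s => ?_
    · have hdig := digit_mul_lt (hp (n + 1)) (hsucc _)
      have hsnd := snd_eq (hp n)
      rw [← Function.iterate_succ_apply' G] at hsnd
      change (digits p (n + 1) : ℝ) * _ < 1 at hdig
      rw [hL] at hdig
      push_cast at hdig
      have hiR : (i : ℝ) ≤ height (digits p) n 0 := by exact_mod_cast hi
      have hpos : 0 < (G^[n + 1] p).1 := by linarith
      change |(i : ℝ) * (G^[n] p).2| ≤ _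
      rw [abs_of_nonneg (by positivity), le_div_iff₀ (by positivity)]
      have hle : (G^[n] p).2 ≤ (G^[n + 1] p).1 := by
        rw [hsnd]; exact mul_le_of_le_one_left (by linarith) a2.le
      calc (i : ℝ) * (G^[n] p).2 * (n + 1)
          ≤ height (digits p) n 0 * (G^[n + 1] p).1 * repetition (digits p) n := by gcongr
        _ ≤ 1 := by linarith
    · exact height_add_le_of_goodAt h s (mul_comm _ _) hi hv (by omega)
  · refine frequentlyVisits_recurrenceSet hp (r := k) (fun s => ⟨_, _, hword s⟩) ?_ fun s => ?_
    · have hdig := digit_mul_lt (hp n) (hsucc _)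
      change (digits p n : ℝ) * _ < 1 at hdig
      rw [hK] at hdig
      push_cast at hdig
      have hjR : (j : ℝ) ≤ height (digits p) n 1 := by exact_mod_cast hj
      have hpos : 0 < (G^[n] p).1 := by linarith
      change |(j : ℝ) * (G^[n] p).1| ≤ _
      rw [abs_of_nonneg (by positivity), le_div_iff₀ (by positivity)]
      calc (j : ℝ) * (G^[n] p).1 * (n + 1)
          ≤ height (digits p) n 1 * (G^[n] p).1 * repetition (digits p) n := by gcongr
        _ ≤ 1 := by linarith
    · exact height_add_le_of_goodAt h s rfl hj hw (by omega)

theorem isOpen_setOf_goodAt (n : ℕ) : IsOpen {p : OmegaInfty | GoodAt (digits p) n} := by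
  refine isOpen_iff_mem_nhds.2 fun p hp => ?_
  have h := continuous_subtype_val.continuousAt.eventually (eventually_digits_eq p.2 (n + 3))
  filter_upwards [h] with q hq
  exact goodAt_congr (fun i hi => (hq i hi).symm) hp

theorem exists_goodAt_dist_lt {p : ℝ × ℝ} (hp : p ∈ OmegaInfty) (m : ℕ) {ε : ℝ} (hε : 0 < ε) :
    ∃ q ∈ OmegaInfty, dist q p < ε ∧ ∃ n ≥ m, GoodAt (digits q) n := by
  obtain ⟨n₀, hn₀⟩ := exists_dist_lt_of_digits_eq hp hε
  set n := max n₀ m with hn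
  set d := digits p with hd
  obtain ⟨k, hk1, hk⟩ := exists_coprime_add_mul (a := height d n 0) (height_pos d n 1).ne'
    (c := height d n 2) fun g h0 h1 h2 =>
      eq_one_of_dvd_height (d := d) (n := n) (fun i _ => one_le_digit (hp i)) fun s => by
        fin_cases s
        exacts [h0, h1, h2]
  set d' : ℕ → ℕ := fun i => if i < n then d i else k with hd'
  have hN : 1 ≤ repetition d' (n + 1) := by unfold repetition; omega
  obtain ⟨K, hKd⟩ : ∃ K, K = repetition d' (n + 1) * height d' (n + 1) 1 := ⟨_, rfl⟩
  obtain ⟨L, hLd⟩ : ∃ L, L = repetition d' (n + 1) * height d' (n + 1) 0 := ⟨_, rfl⟩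
  have hK : 1 ≤ K := hKd ▸ Nat.mul_pos hN (height_pos d' (n + 1) 1)
  have hL : 1 ≤ L := hLd ▸ Nat.mul_pos hN (height_pos d' (n + 1) 0)
  have m1 := branch_mem le_rfl hp
  have m2 := branch_mem hL m1
  have m3 := branch_mem hK m2
  have m4 := branch_mem hk1 m3
  obtain ⟨q, hq, hqd, hqn⟩ := exists_digit_eq_and_iterate_eq m4 n hp
  have g4 := branch_spec hk1 (m3 0)
  have g3 := branch_spec hK (m2 0)
  have g2 := branch_spec hL (m1 0)
  have g1 := branch_spec le_rfl (hp 0)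
  simp only [Function.iterate_zero, id] at g1 g2 g3 g4
  have q1 : G^[n + 1] q = branch K (branch L (branch 1 p)) := by
    rw [Function.iterate_succ_apply', hqn, g4.2.2]
  have q2 : G^[n + 2] q = branch L (branch 1 p) := by
    rw [Function.iterate_succ_apply', q1, g3.2.2]
  have q3 : G^[n + 3] q = branch 1 p := by
    rw [Function.iterate_succ_apply', q2, g2.2.2]
  have hqdig : ∀ i < n, digits q i = d i := hqd
  have hcongr : ∀ i < n + 1, d' i = digits q i := by
    intro i hi
    rcases Nat.lt_succ_iff_lt_or_eq.1 hi with h | rfl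
    · simp only [hd', if_pos h, hqdig i h]
    · simp only [hd', lt_irrefl, if_false, digits, hqn, g4.2.1]
  refine ⟨q, hq, hn₀ q hq fun i hi => hqdig i (by omega), n + 1, by omega, ?_⟩
  have hh := height_congr hcongr
  have hrep : repetition d' (n + 1) = repetition (digits q) (n + 1) := by
    unfold repetition; rw [hh]
  refine ⟨?_, ?_, ?_, ?_⟩
  · have hh' := height_congr hqdig
    rw [height_succ_zero, height_succ_one, hh', hh', hh', digits, hqn, g4.2.1]
    exact hk
  · rw [digits, q1, g3.2.1, hKd, hrep, hh]
  · rw [digits, q2, g2.2.1, hLd, hrep, hh]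
  · rw [digits, q3, g1.2.1]

/-- The parameters with infinitely many good levels. -/
def genericSet : Set OmegaInfty := ⋂ m : ℕ, ⋃ n ≥ m, {p : OmegaInfty | GoodAt (digits p) n}

theorem isGδ_genericSet : IsGδ genericSet :=
  IsGδ.iInter_of_isOpen fun _ => isOpen_biUnion fun n _ => isOpen_setOf_goodAt n

theorem dense_genericSet : Dense genericSet := by
  have : BaireSpace OmegaInfty := isGδ_OmegaInfty.baireSpace_of_t2Space_locallyCompactSpace
  refine dense_iInter_of_isOpen (fun m => isOpen_biUnion fun n _ => isOpen_setOf_goodAt n)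
    fun m => Metric.dense_iff.2 fun p ε hε => ?_
  obtain ⟨q, hq, hqp, n, hn, hgood⟩ := exists_goodAt_dist_lt p.2 m hε
  exact ⟨⟨q, hq⟩, hqp, Set.mem_biUnion hn hgood⟩

/-! ### Eigenvalues -/

theorem eq_one_of_tendsto_pow {c : ℂ} {a : ℕ → ℕ} (h : Tendsto (fun l => c ^ a l) atTop (𝓝 1))
    (h' : Tendsto (fun l => c ^ (a l + 1)) atTop (𝓝 1)) : c = 1 := by
  have h2 : Tendsto (fun l => c ^ (a l + 1)) atTop (𝓝 (1 * c)) := by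
    simp only [pow_succ]
    exact h.mul_const c
  rw [one_mul] at h2
  exact tendsto_nhds_unique h2 h'

theorem FrequentlyVisits.mono {p : ℝ × ℝ} {A B : Set ℝ} (h : FrequentlyVisits p A) (hAB : A ⊆ B) :
    FrequentlyVisits p B := by
  obtain ⟨C, hC⟩ := h
  refine ⟨C, fun x hx m => (hC x hx m).trans (Finset.sum_le_sum fun i _ => ?_)⟩
  exact sub_le_sub_right (Set.indicator_le_indicator_of_subset hAB (fun _ => zero_le_one) _) _

theorem recurrenceSet_anti (p : ℝ × ℝ) (a : ℕ) {M N : ℕ} (h : M ≤ N) :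
    recurrenceSet p a N ⊆ recurrenceSet p a M := fun _ hx =>
  ⟨hx.1.trans (by gcongr), fun t ht => hx.2 t (ht.trans_le h)⟩

theorem FrequentlyVisits.exists_iterate_mem {p : ℝ × ℝ} {A : Set ℝ} (h : FrequentlyVisits p A)
    {x : ℝ} (hx : x ∈ Set.Icc (0 : ℝ) 1) : ∃ i, (T p)^[i] x ∈ A := by
  by_contra! hcon
  obtain ⟨C, hC⟩ := h
  obtain ⟨m, hm⟩ := exists_nat_gt (10 * C)
  have := hC x hx m
  have hs : birkhoffSum (T p) (visitExcess A) m x = m * (-(1 / 10)) := by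
    rw [birkhoffSum, Finset.sum_congr rfl fun i _ => by
      rw [visitExcess, Set.indicator_of_notMem (hcon i)]]
    simp
  rw [hs] at this
  linarith

theorem iterate_shift_apply (x : ℕ → Fin 3) (n t : ℕ) : shift^[n] x t = x (t + n) := by
  induction n generalizing x with
  | zero => rfl
  | succ n ih => rw [Function.iterate_succ_apply, ih]; rfl

theorem iterate_shift_mem_subshift (p : ℝ × ℝ) (n : ℕ) :
    shift^[n] (itinerary p 1) ∈ subshift p := subset_closure ⟨n, rfl⟩

theorem tendsto_pow_of_continuous_eigenfunction {p : ℝ × ℝ} {c : ℂ} (hc : ‖c‖ = 1)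
    {f : (ℕ → Fin 3) → ℂ} (hf : ContinuousOn f (subshift p)) (hf0 : ∃ x ∈ subshift p, f x ≠ 0)
    (hfc : ∀ x ∈ subshift p, f (shift x) = c * f x) {a : ℕ → ℕ}
    (ha : ∀ l, FrequentlyVisits p (recurrenceSet p (a l) l)) :
    Tendsto (fun l => c ^ a l) atTop (𝓝 1) := by
  set w := itinerary p 1 with hw
  have hpow : ∀ n m, f (shift^[n] (shift^[m] w)) = c ^ n * f (shift^[m] w) := by
    intro n m
    induction n with
    | zero => simp
    | succ n ih =>
      rw [Function.iterate_succ_apply', hfc _ ?_, ih, pow_succ]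
      · ring
      · rw [← Function.iterate_add_apply]
        exact iterate_shift_mem_subshift p _
  have hfw : f w ≠ 0 := by
    intro h0
    obtain ⟨x, hx, hfx⟩ := hf0
    have hEq : Set.EqOn f 0 (subshift p) := by
      refine Set.EqOn.of_subset_closure (s := Set.range fun n => shift^[n] w) ?_ hf
        continuousOn_const subset_closure subset_rfl
      rintro _ ⟨n, rfl⟩
      have := hpow n 0
      simp only [Function.iterate_zero, id, h0, mul_zero] at this
      exact this
    exact hfx (hEq hx)
  have hnorm : ∀ n, ‖f (shift^[n] w)‖ = ‖f w‖ := by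
    intro n
    have := hpow n 0
    simp only [Function.iterate_zero, id] at this
    rw [this, norm_mul, norm_pow, hc, one_pow, one_mul]
  choose i hi using fun l => (ha l).exists_iterate_mem (x := 1) (by simp)
  have hagree : ∀ l, ∀ t < l, shift^[a l] (shift^[i l] w) t = shift^[i l] w t := by
    intro l t ht
    have := (hi l).2 t ht
    rw [iterate_shift_apply, iterate_shift_apply, iterate_shift_apply]
    simp only [hw, itinerary]
    rw [← Function.iterate_add_apply, ← Function.iterate_add_apply,
      ← Function.iterate_add_apply] at this
    rw [this]
  refine tendsto_of_subseq_tendsto fun ns hns => ?_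
  have hcomp : IsCompact (subshift p) := isClosed_closure.isCompact
  obtain ⟨x, hx, φ, hφ, hlim⟩ := hcomp.tendsto_subseq
    (x := fun l => shift^[i (ns l)] w) fun l => iterate_shift_mem_subshift p _
  refine ⟨φ, ?_⟩
  have hns' : Tendsto (fun l => ns (φ l)) atTop atTop := hns.comp hφ.tendsto_atTop
  have hlim' : Tendsto (fun l => shift^[a (ns (φ l))] (shift^[i (ns (φ l))] w)) atTop (𝓝 x) := by
    rw [tendsto_pi_nhds] at hlim ⊢
    intro t
    refine (hlim t).congr' ?_
    filter_upwards [hns'.eventually_gt_atTop t] with l hl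
    exact (hagree _ t hl).symm
  have h1 : Tendsto (fun l => f (shift^[i (ns (φ l))] w)) atTop (𝓝 (f x)) :=
    (hf x hx).tendsto.comp (tendsto_nhdsWithin_iff.2
      ⟨hlim, Eventually.of_forall fun l => iterate_shift_mem_subshift p _⟩)
  have h2 : Tendsto (fun l => f (shift^[a (ns (φ l))] (shift^[i (ns (φ l))] w))) atTop
      (𝓝 (f x)) :=
    (hf x hx).tendsto.comp (tendsto_nhdsWithin_iff.2
      ⟨hlim', Eventually.of_forall fun l => by
        rw [← Function.iterate_add_apply]; exact iterate_shift_mem_subshift p _⟩)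
  have hfx : f x ≠ 0 := by
    have := tendsto_nhds_unique h1.norm (tendsto_const_nhds.congr fun l => (hnorm _).symm)
    rw [← norm_ne_zero_iff, this, norm_ne_zero_iff]
    exact hfw
  have h3 := h2.div h1 hfx
  rw [div_self hfx] at h3
  refine h3.congr fun l => ?_
  have hne : f (shift^[i (ns (φ l))] w) ≠ 0 := by
    rw [← norm_ne_zero_iff, hnorm, norm_ne_zero_iff]; exact hfw
  simp only [Pi.div_apply]
  rw [hpow, mul_div_cancel_right₀ _ hne]

/-- A function whose Birkhoff sums are bounded below has nonnegative integral against every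
invariant weight. -/
theorem integral_mul_nonneg_of_birkhoffSum_bounded_below {X : Type*} [MeasurableSpace X]
    {μ : Measure X} {f : X → X} (hf : MeasurePreserving f μ μ) {e g : X → ℝ}
    (he : Integrable e μ) (he0 : ∀ x, 0 ≤ e x) (hef : ∀ᵐ x ∂μ, e (f x) = e x)
    (hg : Measurable g) {B : ℝ} (hgB : ∀ x, ‖g x‖ ≤ B) {C : ℝ}
    (hC : ∀ᵐ x ∂μ, ∀ m, -C ≤ birkhoffSum f g m x) : 0 ≤ ∫ x, e x * g x ∂μ := by
  have hint : ∀ i, Integrable (fun x => e x * g (f^[i] x)) μ := fun i =>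
    he.mul_bdd (c := B) (hg.comp (hf.measurable.iterate i)).aestronglyMeasurable
      (Eventually.of_forall fun x => hgB _)
  have heq : ∀ i, ∫ x, e x * g (f^[i] x) ∂μ = ∫ x, e x * g x ∂μ := by
    intro i
    induction i with
    | zero => rfl
    | succ i ih =>
      rw [← ih]
      have hmap : ∫ x, e x * g (f^[i] x) ∂μ = ∫ x, e (f x) * g (f^[i] (f x)) ∂μ := by
        conv_lhs => rw [← hf.map_eq]
        rw [integral_map hf.aemeasurable]
        rw [hf.map_eq]
        exact (hint i).aestronglyMeasurable
      rw [hmap]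
      refine integral_congr_ae ?_
      filter_upwards [hef] with x hx
      rw [hx, Function.iterate_succ_apply]
  have hsum : ∀ m : ℕ, -(C * ∫ x, e x ∂μ) ≤ m * ∫ x, e x * g x ∂μ := by
    intro m
    have h1 : ∫ x, e x * birkhoffSum f g m x ∂μ = m * ∫ x, e x * g x ∂μ := by
      simp only [birkhoffSum, Finset.mul_sum]
      rw [integral_finsetSum _ fun i _ => hint i]
      simp [heq]
    rw [← h1, ← integral_const_mul, ← integral_neg]
    refine integral_mono_ae (he.const_mul C).neg ?_ ?_
    · simp only [birkhoffSum, Finset.mul_sum]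
      exact integrable_finsetSum _ fun i _ => hint i
    · filter_upwards [hC] with x hx
      have := mul_le_mul_of_nonneg_left (hx m) (he0 x)
      change -(C * e x) ≤ _
      linarith
  by_contra! hneg
  obtain ⟨m, hm⟩ := exists_nat_gt ((C * ∫ x, e x ∂μ) / -(∫ x, e x * g x ∂μ))
  rw [div_lt_iff₀ (by linarith)] at hm
  linarith [hsum m]

theorem norm_pow_sub_one_mul_le {p : ℝ × ℝ} {c : ℂ} (hc : ‖c‖ = 1) {μ : Measure ℝ}
    (hμ : ∀ᵐ x ∂μ, x ∈ Set.Icc (0 : ℝ) 1) (hT : MeasurePreserving (T p) μ μ) {f g : ℝ → ℂ}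
    (hf : Integrable f μ) (hfc : ∀ᵐ x ∂μ, f (T p x) = c * f x) [IsProbabilityMeasure μ]
    (hg : Integrable g μ) {a M : ℕ} (ha : FrequentlyVisits p (recurrenceSet p a M)) {η : ℝ}
    (hη : ∀ x y : ℝ, |x - y| ≤ 1 / (M + 1) → ‖g x - g y‖ ≤ η) :
    ‖c ^ a - 1‖ * (1 / 10 * ∫ x, ‖f x‖ ∂μ) ≤ 2 * (∫ x, ‖f x - g x‖ ∂μ) + η := by
  set A : Set ℝ := {x | |(T p)^[a] x - x| ≤ 1 / (M + 1)} with hAdef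
  have hTa : MeasurePreserving (T p)^[a] μ μ := hT.iterate a
  have hA : MeasurableSet A :=
    measurableSet_le ((hTa.measurable.sub measurable_id).abs) measurable_const
  have hvis : FrequentlyVisits p A := ha.mono fun x hx => hx.1
  obtain ⟨C, hC⟩ := hvis
  have hmeas : Measurable (visitExcess A) := (measurable_one.indicator hA).sub_const _
  have hind : ∀ x, A.indicator (1 : ℝ → ℝ) x = 0 ∨ A.indicator (1 : ℝ → ℝ) x = 1 := fun x =>
    (Set.indicator_eq_zero_or_self A 1 x).imp id id
  have hnn := integral_mul_nonneg_of_birkhoffSum_bounded_below hT hf.norm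
    (fun x => norm_nonneg (f x)) (by
      filter_upwards [hfc] with x hx
      rw [hx, norm_mul, hc, one_mul]) hmeas (B := 1) (fun x => by
      rw [Real.norm_eq_abs, abs_le, visitExcess]
      rcases hind x with h | h <;> rw [h] <;> norm_num) (C := C) (by
      filter_upwards [hμ] with x hx
      exact hC x hx)
  have hfA : Integrable (fun x => ‖f x‖ * A.indicator 1 x) μ :=
    hf.norm.mul_bdd (c := 1) (measurable_one.indicator hA).aestronglyMeasurable
      (Eventually.of_forall fun x => by rcases hind x with h | h <;> rw [h] <;> norm_num)
  have hlow : 1 / 10 * ∫ x, ‖f x‖ ∂μ ≤ ∫ x, ‖f x‖ * A.indicator 1 x ∂μ := by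
    simp only [visitExcess, mul_sub] at hnn
    rw [integral_sub hfA (hf.norm.mul_const _), integral_mul_const] at hnn
    linarith
  have hiter : ∀ᵐ x ∂μ, f ((T p)^[a] x) = c ^ a * f x := by
    clear hTa hAdef ha hC hA hmeas hind hnn hfA hlow
    induction a with
    | zero => simp
    | succ a ih =>
      filter_upwards [ih, (hT.iterate a).quasiMeasurePreserving.ae hfc] with x h1 h2
      rw [Function.iterate_succ_apply', h2, h1, pow_succ]
      ring
  have hη0 : 0 ≤ η := (norm_nonneg _).trans (hη 0 0 (by simp; positivity))
  have hfg : Integrable (fun x => ‖f x - g x‖) μ := (hf.sub hg).norm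
  have hfgT : Integrable (fun x => ‖f ((T p)^[a] x) - g ((T p)^[a] x)‖) μ :=
    hTa.integrable_comp_of_integrable hfg
  have hintT : ∫ x, ‖f ((T p)^[a] x) - g ((T p)^[a] x)‖ ∂μ = ∫ x, ‖f x - g x‖ ∂μ := by
    conv_rhs => rw [← hTa.map_eq]
    rw [integral_map hTa.aemeasurable]
    rw [hTa.map_eq]
    exact hfg.aestronglyMeasurable
  calc ‖c ^ a - 1‖ * (1 / 10 * ∫ x, ‖f x‖ ∂μ)
      ≤ ‖c ^ a - 1‖ * ∫ x, ‖f x‖ * A.indicator 1 x ∂μ := by gcongr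
    _ = ∫ x, ‖c ^ a - 1‖ * (‖f x‖ * A.indicator 1 x) ∂μ := (integral_const_mul _ _).symm
    _ ≤ ∫ x, (‖f ((T p)^[a] x) - g ((T p)^[a] x)‖ + ‖f x - g x‖ + η) ∂μ := by
        refine integral_mono_ae (hfA.const_mul _)
          ((hfgT.add hfg).add (integrable_const η)) ?_
        filter_upwards [hiter] with x hx
        change ‖c ^ a - 1‖ * (‖f x‖ * A.indicator 1 x) ≤ _
        by_cases hxA : x ∈ A
        · rw [Set.indicator_of_mem hxA, Pi.one_apply, mul_one, ← norm_mul, sub_mul, one_mul, ← hx]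
          have h1 := hη _ _ hxA
          calc ‖f ((T p)^[a] x) - f x‖ = ‖(f ((T p)^[a] x) - g ((T p)^[a] x)) +
                (g x - f x) + (g ((T p)^[a] x) - g x)‖ := by congr 1; ring
            _ ≤ ‖f ((T p)^[a] x) - g ((T p)^[a] x)‖ + ‖g x - f x‖ +
                ‖g ((T p)^[a] x) - g x‖ := norm_add₃_le
            _ ≤ _ := by rw [norm_sub_rev (g x)]; gcongr
        · rw [Set.indicator_of_notMem hxA, mul_zero, mul_zero]
          positivity
    _ = _ := by
        have hsum : Integrable (fun x => ‖f ((T p)^[a] x) - g ((T p)^[a] x)‖ + ‖f x - g x‖) μ :=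
          hfgT.add hfg
        rw [integral_add hsum (integrable_const η), integral_add hfgT hfg, hintT, integral_const,
          probReal_univ, one_smul]
        ring

theorem tendsto_pow_of_measurable_eigenfunction {p : ℝ × ℝ} {c : ℂ} (hc : ‖c‖ = 1)
    {μ : Measure ℝ} [IsProbabilityMeasure μ] (hμ : ∀ᵐ x ∂μ, x ∈ Set.Icc (0 : ℝ) 1)
    (hT : MeasurePreserving (T p) μ μ) {f : ℝ → ℂ} (hf : Integrable f μ) (hf0 : ¬ f =ᵐ[μ] 0)
    (hfc : ∀ᵐ x ∂μ, f (T p x) = c * f x) {a : ℕ → ℕ}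
    (ha : ∀ l, FrequentlyVisits p (recurrenceSet p (a l) l)) :
    Tendsto (fun l => c ^ a l) atTop (𝓝 1) := by
  have hpos : 0 < 1 / 10 * ∫ x, ‖f x‖ ∂μ := by
    refine mul_pos (by norm_num) ((integral_pos_iff_support_of_nonneg
      (fun x => norm_nonneg _) hf.norm).2 (pos_iff_ne_zero.2 fun h => hf0 ?_))
    filter_upwards [compl_mem_ae_iff.2 h] with x hx
    simpa using hx
  set I := 1 / 10 * ∫ x, ‖f x‖ ∂μ with hI
  refine Metric.tendsto_atTop.2 fun ε hε => ?_
  have hε' : 0 < ε * I / 4 := by positivity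
  obtain ⟨g, hgs, hfg, hgc, hgi⟩ := hf.exists_hasCompactSupport_integral_sub_le hε'
  obtain ⟨δ, hδ, hgδ⟩ := Metric.uniformContinuous_iff.1
    (hgs.uniformContinuous_of_continuous hgc) _ hε'
  obtain ⟨N, hN⟩ := exists_nat_one_div_lt hδ
  refine ⟨N, fun l hl => ?_⟩
  have hlN : 1 / ((l : ℝ) + 1) < δ := lt_of_le_of_lt (by gcongr) hN
  have key := norm_pow_sub_one_mul_le hc hμ hT hf hfc hgi (ha l) (η := ε * I / 4)
    fun x y hxy => by
      rw [← dist_eq_norm]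
      exact (hgδ (lt_of_le_of_lt hxy hlN)).le
  rw [← hI] at key
  rw [dist_eq_norm]
  refine lt_of_mul_lt_mul_right (key.trans_lt ?_) hpos.le
  have : 0 < ε * I := by positivity
  linarith

theorem eq_one_of_isEigenvalue {p : OmegaInfty} (hp : p ∈ genericSet) {c : ℂ} (hc : ‖c‖ = 1)
    (h : IsEigenvalue p c) : c = 1 := by
  have hex : ∀ l : ℕ, ∃ a, FrequentlyVisits p (recurrenceSet p a l) ∧
      FrequentlyVisits p (recurrenceSet p (a + 1) l) := by
    intro l
    obtain ⟨n, hn, hgood⟩ := Set.mem_iUnion₂.1 (Set.mem_iInter.1 hp l)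
    obtain ⟨a, h1, h2⟩ := exists_frequentlyVisits p.2 hgood
    exact ⟨a, h1.mono (recurrenceSet_anti _ _ hn), h2.mono (recurrenceSet_anti _ _ hn)⟩
  choose a ha ha' using hex
  rcases h with ⟨f, hf, hf0, hfc⟩ | ⟨μ, hμ, hμI, hT, f, hf, hf0, hfc⟩
  · exact eq_one_of_tendsto_pow (tendsto_pow_of_continuous_eigenfunction hc hf hf0 hfc ha)
      (tendsto_pow_of_continuous_eigenfunction hc hf hf0 hfc ha')
  · have hI : ∀ᵐ x ∂μ, x ∈ Set.Icc (0 : ℝ) 1 := hμI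
    have hfi : Integrable f μ := hf.integrable (by norm_num)
    exact eq_one_of_tendsto_pow (tendsto_pow_of_measurable_eigenfunction hc hI hT hfi hf0 hfc ha)
      (tendsto_pow_of_measurable_eigenfunction hc hI hT hfi hf0 hfc ha')

theorem exp_two_pi_mul_ne_one {ξ : ℝ} (hξ : ξ ∈ Set.Ioo (0 : ℝ) 1) :
    Complex.exp (2 * Real.pi * Complex.I * ξ) ≠ 1 := by
  intro h
  obtain ⟨n, hn⟩ := Complex.exp_eq_one_iff.1 h
  have h2 : (2 * Real.pi * Complex.I : ℂ) ≠ 0 := Complex.two_pi_I_ne_zero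
  have h3 : (ξ : ℂ) = n := mul_left_cancel₀ h2 (by rw [hn]; ring)
  have h4 : ξ = n := by exact_mod_cast h3
  rw [h4] at hξ
  have h5 : (0 : ℤ) < n := by exact_mod_cast hξ.1
  have h6 : n < (1 : ℤ) := by exact_mod_cast hξ.2
  omega

theorem norm_exp_two_pi_mul (ξ : ℝ) : ‖Complex.exp (2 * Real.pi * Complex.I * ξ)‖ = 1 := by
  rw [show (2 * Real.pi * Complex.I * ξ : ℂ) = ((2 * Real.pi * ξ : ℝ) : ℂ) * Complex.I by
    push_cast; ring]
  exact Complex.norm_exp_ofReal_mul_I _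

end ITM

theorem mainTheorem4 :
    ∃ S : Set ITM.OmegaInfty, IsGδ S ∧ Dense S ∧
      S ⊆ {p : ITM.OmegaInfty | ¬ ∃ ξ ∈ Set.Ioo (0 : ℝ) 1,
        ITM.IsEigenvalue (p : ℝ × ℝ) (Complex.exp (2 * Real.pi * Complex.I * ξ))} := by
  refine ⟨ITM.genericSet, ITM.isGδ_genericSet, ITM.dense_genericSet, ?_⟩
  rintro p hp ⟨ξ, hξ, h⟩
  exact ITM.exp_two_pi_mul_ne_one hξ
    (ITM.eq_one_of_isEigenvalue hp (ITM.norm_exp_two_pi_mul ξ) h)
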